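/- A \emph{circular order} on a set $X$ is a ternary relation $[\cdot,\cdot,\cdot]$ such that $[a,b,c]\Rightarrow[b,c,a]$; $[a,b,c]\Rightarrow\neg[b,a,c]$; $[a,b,c]$ and $[a,c,d]$ imply $[a,b,d]$; and any distinct $a,b,c$ satisfy $[a,b,c]$ or $[a,c,b]$. The \emph{cut} at $z\in X$ is the linear order $<_z$ with least element $z$ and $a<_z b\Leftrightarrow[z,a,b]$ for distinct $a,b,z$. A linear order on a finite circularly ordered set is \emph{compatible} if it is $<_z$ for some $z$ (the empty order on the empty set is also compatible). Let $L=\{[\cdot,\cdot,\cdot],<\}$, $L_0=\{[\cdot,\cdot,\cdot]\}$, let $\mathcal K$ be the class of all finite circularly ordered sets with a compatible linear order, and $\mathcal K_0=\mathcal K|L_0$ the class of $L_0$-reducts of its members. Let $\mathbb T=\mathbb R/\mathbb Z$ and let $\mathbb Q_\circ=\mathbb Q/\mathbb Z\subset\mathbb T$ carry the circular order inherited from $\mathbb T$. Let $G_0=\mathrm{Aut}(\mathbb Q_\circ)$ with the topology of pointwise convergence on the discrete set $\mathbb Q_\circ$. Let $X_{\mathcal K}\subset\{0,1\}^{\mathbb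 Q_\circ\times\mathbb Q_\circ}$ be the space, with the topology of pointwise convergence, of all linear orders $\prec$ on $\mathbb Q_\circ$ that are $\mathcal K$-admissible, i.e. $(A_0,\prec|_{A_0})\in\mathcal K$ for every finite substructure $A_0\subset\mathbb Q_\circ$; $G_0$ acts on it by $x\,(g\prec)\,y\Leftrightarrow g^{-1}x\prec g^{-1}y$. Let $\mathrm{Split}(\mathbb T;\mathbb Q_\circ)$ be the set obtained from $\mathbb T$ by replacing each $q\in\mathbb Q_\circ$ by two points $q^-,q^+$, with the circular order that lifts the one of $\mathbb T$ and satisfies $[q^-,q^+,x]$ for $x\ne q^\pm$, and with its interval topology (a base is given by the complements of the closed intervals $[a,b]=\{x:[a,x,b]\}\cup\{a,b\}$, together with the whole set). A \emph{minimal flow} of a topological group is a continuous action on a nonempty compact Hausdorff space all of whose orbits are dense; it is a \emph{universal minimal flow} if it admits a continuous equivariant map to every minimal flow of the group. \textbf{Theorem.} \begin{enumerate} \item $\mathcal K$ is a Fra\"iss\'e order class: it consists of finite structures in which $<$ is a linear order, is hereditary, has the joint embedding and amalgamation properties, countably many isomorphism types and members of arbitrarily large finite size. It is reasonable: for every embedding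 $\pi:A_0\to B_0$ of members of $\mathcal K_0$ and every linear order $\prec$ on $A_0$ with $(A_0,\prec)\in\mathcal K$ there is a linear order $\prec'$ on $B_0$ such that $(B_0,\prec')\in\mathcal K$ and $\pi:(A_0,\prec)\to(B_0,\prec')$ is an embedding. It has the Ramsey property: for all $A,B\in\mathcal K$ such that $A$ embeds in $B$ and all $k\ge2$ there is $C\in\mathcal K$ into which $B$ embeds such that for every $k$-colouring of the substructures of $C$ isomorphic to $A$ there is a substructure $B'\cong B$ of $C$ in which all the substructures isomorphic to $A$ have the same colour. It has the ordering property: for every $A_0\in\mathcal K_0$ there is $B_0\in\mathcal K_0$ such that $(A_0,\prec)$ embeds in $(B_0,\prec')$ for all linear orders with $(A_0,\prec),(B_0,\prec')\in\mathcal K$. \item $\mathbb Q_\circ$ is the Fra\"iss\'e limit of $\mathcal K_0$. For every irrational $\alpha\in\mathbb R$, let $\prec_\alpha$ be the order on $\mathbb Q_\circ$ obtained by identifying $\mathbb Q_\circ$ with the set of its representatives in $(\alpha,\alpha+1)$. Then $\prec_\alpha$ is a dense linear order and $(\mathbb Q_\circ,[\cdot,\cdot,\cdot],\prec_\alpha)$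 is the Fra\"iss\'e limit of $\mathcal K$. \item $X_{\mathcal K}$ is a universal minimal flow of $G_0$. There is exactly one action of $G_0$ on $\mathrm{Split}(\mathbb T;\mathbb Q_\circ)$ by automorphisms of the circular order such that $g\,q^-=(gq)^-$ and $g\,q^+=(gq)^+$ for all $g\in G_0$, $q\in\mathbb Q_\circ$. With this action $\mathrm{Split}(\mathbb T;\mathbb Q_\circ)$ is a universal minimal flow of $G_0$, and there is a $G_0$-equivariant homeomorphism $\mathrm{Split}(\mathbb T;\mathbb Q_\circ)\to X_{\mathcal K}$. \end{enumerate} -/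

import Mathlib

open FirstOrder FirstOrder.Language CategoryTheory

namespace CircularFlow

/-! ### Circular orders and cuts -/

/-- A circular order on `X`, as a strict ternary relation. -/
structure IsCircularOrder {X : Type*} (R : X → X → X → Prop) : Prop where
  cyclic : ∀ a b c, R a b c → R b c a
  asymm : ∀ a b c, R a b c → ¬ R b a c
  trans : ∀ a b c d, R a b c → R a c d → R a b d
  total : ∀ a b c, a ≠ b → b ≠ c → c ≠ a → R a b c ∨ R a c b

/-- The linear order `<_z` obtained by cutting a circular order at the point `z`: the point `z` is
the least element, and `a <_z b` iff `[z, a, b]` for the other points. -/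
def cutAt {X : Type*} (R : X → X → X → Prop) (z a b : X) : Prop :=
  (a = z ∧ b ≠ z) ∨ R z a b

/-- A linear order on a finite circularly ordered set is compatible if it is obtained by a cut.
(On the empty set, the empty order is compatible.) -/
def IsCompatible {X : Type*} (R : X → X → X → Prop) (r : X → X → Prop) : Prop :=
  IsEmpty X ∨ ∃ z, ∀ a b, r a b ↔ cutAt R z a b

/-! ### Order classes: a relational language `L₀` expanded by a binary symbol `<` -/

inductive LtRel : ℕ → Type
  | lt : LtRel 2

/-- The language with a single binary relation symbol `<`. -/
def ltLang : FirstOrder.Language.{0, 0} := ⟨fun _ => Empty, LtRel⟩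

@[reducible] def ltStructure {X : Type*} (r : X → X → Prop) : ltLang.Structure X where
  funMap := fun f => Empty.elim f
  RelMap := fun {_} s => match s with
    | LtRel.lt => fun v => r (v 0) (v 1)

section OrderClasses

variable {L₀ : FirstOrder.Language.{0, 0}}

/-- The interpretation of the symbol `<` in a structure of the language `L₀ ∪ {<}`. -/
def ltOf (L₀ : FirstOrder.Language.{0, 0}) (A : Type*) [(L₀.sum ltLang).Structure A] (a b : A) : Prop :=
  Structure.RelMap (L := L₀.sum ltLang) (M := A) (n := 2) (Sum.inr LtRel.lt) ![a, b]

/-- The structure `(A₀, r)` of the language `L₀ ∪ {<}`. -/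
@[reducible] def expansionStructure (A : Type*) [L₀.Structure A] (r : A → A → Prop) :
    (L₀.sum ltLang).Structure A :=
  letI := ltStructure r
  FirstOrder.Language.sumStructure L₀ ltLang A

def expansion (A : Type) [L₀.Structure A] (r : A → A → Prop) :
    Bundled.{0} (L₀.sum ltLang).Structure :=
  ⟨A, expansionStructure A r⟩

variable (K : Set (Bundled.{0} (L₀.sum ltLang).Structure))

/-- `K | L₀`, the class of the `L₀`-reducts of the structures in `K`. -/
def reductClass : Set (Bundled.{0} L₀.Structure) :=
  {A₀ | ∃ r : A₀ → A₀ → Prop, expansion A₀ r ∈ K}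

/-- A Fraïssé class of finite structures (hereditary, joint embedding, amalgamation, countably many
isomorphism types, arbitrarily large finite members) in which `<` is always a linear order. -/
structure IsFraisseOrderClass : Prop where
  isFraisse : IsFraisse K
  finite : ∀ A ∈ K, Finite A
  unbounded : ∀ n : ℕ, ∃ A ∈ K, n ≤ Nat.card A
  linear : ∀ A ∈ K, IsStrictTotalOrder A (ltOf L₀ A)

/-- Every embedding `π : A₀ → B₀` of members of `K | L₀` and every `(A₀, r) ∈ K` admit `(B₀, r') ∈ K`
such that `π` is also an embedding of `(A₀, r)` into `(B₀, r')`. -/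
def IsReasonable : Prop :=
  ∀ A₀ ∈ reductClass K, ∀ B₀ ∈ reductClass K, ∀ π : A₀ ↪[L₀] B₀, ∀ r : A₀ → A₀ → Prop,
    IsStrictTotalOrder A₀ r → expansion A₀ r ∈ K →
      ∃ r' : B₀ → B₀ → Prop, IsStrictTotalOrder B₀ r' ∧ expansion B₀ r' ∈ K ∧
        ∀ a b, r a b ↔ r' (π a) (π b)

/-- For every `A₀` there is `B₀` in `K | L₀` such that `(A₀, r)` embeds in `(B₀, r')` for all
linear orders `r`, `r'` with `(A₀, r), (B₀, r') ∈ K`. -/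
def OrderingProperty : Prop :=
  ∀ A₀ ∈ reductClass K, ∃ B₀ ∈ reductClass K,
    ∀ (r : A₀ → A₀ → Prop) (r' : B₀ → B₀ → Prop),
      IsStrictTotalOrder A₀ r → IsStrictTotalOrder B₀ r' →
      expansion A₀ r ∈ K → expansion B₀ r' ∈ K →
        Nonempty (expansion (L₀ := L₀) A₀ r ↪[L₀.sum ltLang] expansion (L₀ := L₀) B₀ r')

/-- A linear order on an `L₀`-structure `M` is `K`-admissible if its restriction to every finite
substructure `A₀` of `M` gives a member `(A₀, <)` of `K`. -/
def IsAdmissible (M : Type) [L₀.Structure M] (r : M → M → Prop) : Prop :=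
  IsStrictTotalOrder M r ∧
    ∀ S : L₀.Substructure M, Finite S → expansion S (fun a b : S => r a b) ∈ K

/-- The space `X_K` of `K`-admissible linear orders on `M`, encoded by their characteristic
functions `M × M → {0, 1}`. -/
def AdmissibleOrders (M : Type) [L₀.Structure M] : Type :=
  {r : M → M → Bool // IsAdmissible K M (fun a b => r a b = true)}

/-- `X_K` carries the topology of pointwise convergence, as a subspace of `{0, 1}^(M × M)`. -/
instance (M : Type) [L₀.Structure M] : TopologicalSpace (AdmissibleOrders K M) :=
  inferInstanceAs (TopologicalSpace {r : M → M → Bool // IsAdmissible K M (fun a b => r a b = true)})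

end OrderClasses

/-- The Ramsey property: for all `A ≤ B` in `K` and every number `k` of colours there is `C ∈ K` with
`B ≤ C` such that, whenever the copies of `A` in `C` are `k`-coloured, there is a copy `B'` of `B`
in `C` such that all the copies of `A` in `B'` have the same colour. -/
def RamseyProperty {L : FirstOrder.Language.{0, 0}} (K : Set (Bundled.{0} L.Structure)) : Prop :=
  ∀ A ∈ K, ∀ B ∈ K, Nonempty (A ↪[L] B) → ∀ k : ℕ, 2 ≤ k →
    ∃ C ∈ K, Nonempty (B ↪[L] C) ∧
      ∀ c : {A' : L.Substructure C // Nonempty (A ≃[L] A')} → Fin k,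
        ∃ B' : L.Substructure C, Nonempty (B ≃[L] B') ∧
          ∃ i : Fin k, ∀ A' : {A' : L.Substructure C // Nonempty (A ≃[L] A')},
            A'.1 ≤ B' → c A' = i

/-! ### Automorphism groups and flows -/

/-- The automorphism group of a first-order structure. -/
def autGroup (L : FirstOrder.Language.{0, 0}) (M : Type) [L.Structure M] : Subgroup (Equiv.Perm M) where
  carrier := {g | ∃ e : M ≃[L] M, e.toEquiv = g}
  mul_mem' := by
    rintro _ _ ⟨e, rfl⟩ ⟨f, rfl⟩
    exact ⟨e.comp f, rfl⟩
  one_mem' := ⟨Language.Equiv.refl L M, rfl⟩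
  inv_mem' := by
    rintro _ ⟨e, rfl⟩
    exact ⟨e.symm, rfl⟩

/-- The topology of pointwise convergence, where `M` is discrete. -/
instance (L : FirstOrder.Language.{0, 0}) (M : Type) [L.Structure M] : TopologicalSpace (autGroup L M) :=
  ⨅ x : M, TopologicalSpace.induced (fun g : autGroup L M => (g : Equiv.Perm M) x) ⊥

/-- A minimal flow of a topological group: a continuous action on a nonempty compact Hausdorff
space all of whose orbits are dense. -/
structure IsMinimalFlow (G : Type*) [Group G] [TopologicalSpace G] (X : Type*) [TopologicalSpace X]
    [MulAction G X] : Prop where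
  nonempty : Nonempty X
  compact : CompactSpace X
  hausdorff : T2Space X
  continuous : ContinuousSMul G X
  minimal : MulAction.IsMinimal G X

/-- `X` is a universal minimal flow of `G`: it is minimal, and it maps equivariantly and
continuously to every minimal flow of `G`. -/
def IsUniversalMinimalFlow.{u} (G : Type*) [Group G] [TopologicalSpace G] (X : Type*)
    [TopologicalSpace X] [MulAction G X] : Prop :=
  IsMinimalFlow G X ∧
    ∀ (Y : Type u) [TopologicalSpace Y] [MulAction G Y], IsMinimalFlow G Y →
      ∃ f : X → Y, Continuous f ∧ ∀ (g : G) (x : X), f (g • x) = g • f x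

/-! ### Finite circularly ordered sets with a compatible linear order -/

inductive CircRel : ℕ → Type
  | circ : CircRel 3

/-- The language with a single ternary relation symbol `[·,·,·]`. -/
def circLang : FirstOrder.Language.{0, 0} := ⟨fun _ => Empty, CircRel⟩

@[reducible] def circStructure {X : Type*} (R : X → X → X → Prop) : circLang.Structure X where
  funMap := fun f => Empty.elim f
  RelMap := fun {_} s => match s with
    | CircRel.circ => fun v => R (v 0) (v 1) (v 2)

/-- The interpretation of `[·,·,·]` in a structure of the language `{[·,·,·], <}`. -/
def circOf (A : Type*) [(circLang.sum ltLang).Structure A] (a b c : A) : Prop :=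
  Structure.RelMap (L := circLang.sum ltLang) (M := A) (n := 3) (Sum.inl CircRel.circ) ![a, b, c]

/-- The class `K` of all finite circularly ordered sets with a compatible linear order. -/
def circClass : Set (Bundled.{0} (circLang.sum ltLang).Structure) :=
  {A | Finite A ∧ IsCircularOrder (circOf A) ∧ IsCompatible (circOf A) (ltOf circLang A)}

instance : Countable (Σ n, circLang.Functions n) :=
  ⟨fun _ => 0, fun x => (x.2 : Empty).elim⟩

instance : Countable (Σ n, (circLang.sum ltLang).Functions n) :=
  ⟨fun _ => 0, fun x => (x.2 : Empty ⊕ Empty).elim Empty.elim Empty.elim⟩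

theorem IsCircularOrder.of_equiv {X Y : Type*} (e : X ≃ Y) {R : X → X → X → Prop}
    {S : Y → Y → Y → Prop} (h : ∀ a b c, R a b c ↔ S (e a) (e b) (e c)) (hR : IsCircularOrder R) :
    IsCircularOrder S := by
  have h' : ∀ a b c, S a b c ↔ R (e.symm a) (e.symm b) (e.symm c) := fun a b c => by simp [h]
  refine ⟨?_, ?_, ?_, ?_⟩
  · intro a b c; simp only [h']; exact hR.cyclic _ _ _
  · intro a b c; simp only [h']; exact hR.asymm _ _ _
  · intro a b c d; simp only [h']; exact hR.trans _ _ _ _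
  · intro a b c; simp only [h']; intro h1 h2 h3
    exact hR.total _ _ _ (by simpa using h1) (by simpa using h2) (by simpa using h3)

theorem IsCompatible.of_equiv {X Y : Type*} (e : X ≃ Y) {R : X → X → X → Prop}
    {S : Y → Y → Y → Prop} {r : X → X → Prop} {s : Y → Y → Prop}
    (h : ∀ a b c, R a b c ↔ S (e a) (e b) (e c)) (h' : ∀ a b, r a b ↔ s (e a) (e b))
    (hr : IsCompatible R r) : IsCompatible S s := by
  rcases hr with hX | ⟨z, hz⟩
  · exact Or.inl e.symm.isEmpty
  · refine Or.inr ⟨e z, fun a b => ?_⟩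
    obtain ⟨a, rfl⟩ := e.surjective a
    obtain ⟨b, rfl⟩ := e.surjective b
    rw [← h', hz]
    simp [cutAt, h]

/-- The class `K` is closed under isomorphism. -/
theorem expansion_mem_of_equiv {A B : Type} [circLang.Structure A] [circLang.Structure B]
    (e : A ≃[circLang] B) {r : A → A → Prop} {s : B → B → Prop}
    (h : ∀ a b, r a b ↔ s (e a) (e b)) (hA : expansion (L₀ := circLang) A r ∈ circClass) :
    expansion (L₀ := circLang) B s ∈ circClass := by
  obtain ⟨hfin, hc, hl⟩ := hA
  have hR : ∀ a b c : A, circOf (expansion (L₀ := circLang) A r) a b c ↔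
      circOf (expansion (L₀ := circLang) B s) (e a) (e b) (e c) := by
    intro a b c
    have := e.map_rel CircRel.circ ![a, b, c]
    have h1 : e ∘ ![a, b, c] = ![e a, e b, e c] := by
      funext i
      fin_cases i <;> rfl
    rw [h1] at this
    exact this.symm
  have : Finite A := hfin
  exact ⟨Finite.of_equiv A e.toEquiv, hc.of_equiv e.toEquiv hR, hl.of_equiv e.toEquiv hR h⟩

section

variable (M : Type) [circLang.Structure M]

theorem IsAdmissible.smul (e : M ≃[circLang] M) {r : M → M → Prop}
    (hr : IsAdmissible circClass M r) :
    IsAdmissible circClass M (fun a b => r (e a) (e b)) := by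
  refine ⟨?_, fun S hS => ?_⟩
  · have := hr.1
    exact (⟨e.toEquiv, Iff.rfl⟩ : (fun a b => r (e a) (e b)) ↪r r).isStrictTotalOrder
  · let e' := e.toEmbedding.comp S.subtype
    have : Finite e'.toHom.range := Finite.of_equiv S e'.equivRange.toEquiv
    exact expansion_mem_of_equiv e'.equivRange.symm (fun a b => by
      obtain ⟨a, rfl⟩ := e'.equivRange.surjective a
      obtain ⟨b, rfl⟩ := e'.equivRange.surjective b
      rw [e'.equivRange.symm_apply_apply, e'.equivRange.symm_apply_apply]
      rfl) (hr.2 e'.toHom.range this)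

/-- The automorphism group acts on `X_K` by `x (g • ≺) y ↔ g⁻¹ x ≺ g⁻¹ y`. -/
instance : MulAction (autGroup circLang M) (AdmissibleOrders circClass M) where
  smul g r := ⟨fun a b => r.1 ((g⁻¹ : autGroup circLang M).1 a) ((g⁻¹ : autGroup circLang M).1 b), by
    obtain ⟨e, he⟩ := (g⁻¹ : autGroup circLang M).2
    rw [← he]
    exact IsAdmissible.smul M e r.2⟩
  one_smul r := rfl
  mul_smul g h r := rfl

end

/-! ### The rational points of the circle -/

/-- `ℚ_∘ = ℚ/ℤ`, as a subset of the circle `𝕋 = ℝ/ℤ`. -/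
def rationalPoints : Set UnitAddCircle := Set.range fun q : ℚ => ((q : ℝ) : UnitAddCircle)

/-- `ℚ_∘` with the circular order inherited from `𝕋`, as a structure. -/
instance : circLang.Structure rationalPoints :=
  circStructure fun a b c => sbtw (a : UnitAddCircle) b c

instance : Countable rationalPoints := (Set.countable_range _).to_subtype

/-- The linear order `≺_α` on `ℚ_∘` obtained by identifying `ℚ_∘` with a set of real
representatives in the interval `(α, α + 1)`. -/
def cutOrder (α : ℝ) (x y : rationalPoints) : Prop :=
  ∃ s t : ℝ, α < s ∧ s < t ∧ t < α + 1 ∧ (s : UnitAddCircle) = x ∧ (t : UnitAddCircle) = y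

/-! ### Splitting points of a circularly ordered set -/

/-- `Split(X; A)`: every point `a ∈ A` is replaced by the two points `a⁻` and `a⁺`. -/
inductive Split {X : Type*} (A : Set X) : Type _
  | single (x : X) (hx : x ∉ A) : Split A
  | minus (a : A) : Split A
  | plus (a : A) : Split A

namespace Split

variable {X : Type*} {A : Set X}

/-- The canonical projection `Split(X; A) → X`. -/
def proj : Split A → X
  | single x _ => x
  | minus a => a
  | plus a => a

/-- `s` and `t` are `a⁻` and `a⁺`, in this order, for some `a ∈ A`. -/
def IsSplitPair (s t : Split A) : Prop := ∃ a, s = minus a ∧ t = plus a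

/-- The circular order of `Split(X; A)`: it lifts that of `X`, and `[a⁻, a⁺, x]` (together with its
cyclic permutations) holds for every `a ∈ A` and every other point `x`. -/
def circ [CircularOrder X] (s t u : Split A) : Prop :=
  sbtw s.proj t.proj u.proj ∨
    (IsSplitPair s t ∧ u.proj ≠ s.proj) ∨ (IsSplitPair t u ∧ s.proj ≠ t.proj) ∨
    (IsSplitPair u s ∧ t.proj ≠ u.proj)

end Split

/-- The interval topology of a circular order: the complements of the closed intervals `[a, b]`
form a base. -/
@[reducible] def intervalTopology {X : Type*} (R : X → X → X → Prop) : TopologicalSpace X :=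
  TopologicalSpace.generateFrom {U | ∃ a b, U = {x | R a x b ∨ x = a ∨ x = b}ᶜ}

instance {X : Type*} [CircularOrder X] (A : Set X) : TopologicalSpace (Split A) :=
  intervalTopology Split.circ

/-- An action of `Aut(ℚ_∘)` on `Split(𝕋; ℚ_∘)` by automorphisms of the circular order which
extends the given action on the split points. -/
structure IsNaturalAction (act : MulAction (autGroup circLang rationalPoints)
    (Split rationalPoints)) : Prop where
  circ_smul : ∀ (g : autGroup circLang rationalPoints) (s t u : Split rationalPoints),
    Split.circ (g • s) (g • t) (g • u) ↔ Split.circ s t u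
  smul_minus : ∀ (g : autGroup circLang rationalPoints) (q : rationalPoints),
    g • Split.minus q = Split.minus (g.1 q)
  smul_plus : ∀ (g : autGroup circLang rationalPoints) (q : rationalPoints),
    g • Split.plus q = Split.plus (g.1 q)

end CircularFlow

open CircularFlow

universe u

namespace CircularFlow

/-! A compatible linear order on a finite set determines the circular order: closing it up by `cyc`
undoes the cut (`isCompatible_iff`). Members of the class are therefore finite linear orders in
disguise, determined up to isomorphism by their size. The Ramsey property becomes the finite Ramsey
theorem, the ordering property holds with `B₀ = A₀`, and an order is extended along an embedding by
cutting at the image of its least point. Cantor's back-and-forth argument gives the Fraïssé limits;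
for the circular order alone, a finite partial automorphism is first linearised by irrational cuts
just before a point and its image (`HasDenseCuts`).

For the flows, fix an admissible dense order `x₀` without endpoints. Ramsey's theorem yields almost
fixed points for its stabiliser in every nonempty compact Hausdorff flow, and compactness turns them
into a fixed point `y₀` (`exists_fixed`). The map `g • x₀ ↦ g • y₀` is well defined on a dense orbit
and extends continuously to all admissible orders (`exists_equivariant_map`). Homogeneity makes
every orbit of admissible orders dense (`isMinimal_admissibleOrders`).

Finally, an admissible order on the rational points is a cut of the circle. Those with a least
element `q` come from `q⁻`, those with a greatest element `q` from `q⁺`, and the others from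
irrational points, as in Dedekind's construction. This is the homeomorphism `Split.cutHomeomorph`.
The action is transported along it; it is the only natural one because the cut at `s` can be read
off from the circular order of `s` and the points `a⁻` (`cut_iff_circ_minus`). -/

/-! ### Circular orders from linear orders -/

/-- The circular order obtained by closing up a linear order. -/
def cyc {X : Type*} (r : X → X → Prop) (a b c : X) : Prop :=
  (r a b ∧ r b c) ∨ (r b c ∧ r c a) ∨ (r c a ∧ r a b)

section cyc

variable {X : Type*} {r s : X → X → Prop}

theorem cyc_rotate {a b c : X} : cyc r a b c ↔ cyc r b c a := by
  unfold cyc; tauto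

theorem isCircularOrder_cyc [IsStrictTotalOrder X r] : IsCircularOrder (cyc r) := by
  have irr : ∀ a, ¬ r a a := irrefl_of r
  have tr : ∀ {a b c}, r a b → r b c → r a c := fun h h' => trans_of r h h'
  have as : ∀ {a b}, r a b → ¬ r b a := fun h => asymm_of r h
  refine ⟨fun a b c h => cyc_rotate.1 h, ?_, ?_, ?_⟩
  · rintro a b c (⟨h, h'⟩ | ⟨h, h'⟩ | ⟨h, h'⟩) (⟨g, g'⟩ | ⟨g, g'⟩ | ⟨g, g'⟩) <;>
      first
        | exact as h g | exact as h g' | exact as h' g | exact as h' g'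
  · rintro a b c d (⟨h, h'⟩ | ⟨h, h'⟩ | ⟨h, h'⟩) (⟨g, g'⟩ | ⟨g, g'⟩ | ⟨g, g'⟩)
    · exact Or.inl ⟨h, tr h' g'⟩
    · exact (as g' (tr (tr h h') g)).elim
    · exact Or.inr (Or.inr ⟨g, h⟩)
    · exact (as h' g).elim
    · exact Or.inr (Or.inl ⟨tr h g, g'⟩)
    · exact (as h' g').elim
    · exact (as h g).elim
    · exact Or.inr (Or.inr ⟨g', h'⟩)
    · exact (as h g').elim
  · intro a b c hab hbc hca
    unfold cyc
    rcases trichotomous_of r a b with h | h | h <;>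
    rcases trichotomous_of r b c with h' | h' | h' <;>
    rcases trichotomous_of r c a with h'' | h'' | h'' <;> tauto

theorem cyc_congr {Y : Type*} {s : Y → Y → Prop} (f : X → Y) (h : ∀ a b, r a b ↔ s (f a) (f b))
    (a b c : X) : cyc r a b c ↔ cyc s (f a) (f b) (f c) := by
  simp [cyc, h]

theorem cyc_ne [IsStrictTotalOrder X r] {a b c : X} (h : cyc r a b c) : a ≠ b ∧ b ≠ c ∧ c ≠ a := by
  have irr : ∀ a, ¬ r a a := irrefl_of r
  have as : ∀ {a b}, r a b → ¬ r b a := fun h => asymm_of r h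
  have hR := isCircularOrder_cyc (r := r)
  have key : ∀ {a c}, ¬ cyc r a a c := fun h => hR.asymm _ _ _ h h
  refine ⟨?_, ?_, ?_⟩ <;> rintro rfl
  · exact key h
  · exact key (cyc_rotate.1 h)
  · exact key (cyc_rotate.1 (cyc_rotate.1 h))

theorem IsCircularOrder.ne {R : X → X → X → Prop} (hR : IsCircularOrder R) {a b c : X}
    (h : R a b c) : a ≠ b ∧ b ≠ c ∧ c ≠ a := by
  have key : ∀ {a c}, ¬ R a a c := fun h => hR.asymm _ _ _ h h
  refine ⟨?_, ?_, ?_⟩ <;> rintro rfl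
  · exact key h
  · exact key (hR.cyclic _ _ _ h)
  · exact key (hR.cyclic _ _ _ (hR.cyclic _ _ _ h))

theorem isStrictTotalOrder_cutAt {R : X → X → X → Prop} (hR : IsCircularOrder R) (z : X) :
    IsStrictTotalOrder X (cutAt R z) := by
  refine { irrefl := ?irr, trans := ?tr, trichotomous := ?tri }
  case irr =>
    rintro a (h | h)
    · exact h.2 h.1
    · exact (hR.ne h).2.1 rfl
  case tr =>
    rintro a b c (⟨rfl, h⟩ | h) (⟨rfl, h'⟩ | h')
    · exact (h rfl).elim
    · exact Or.inl ⟨rfl, (hR.ne h').2.2⟩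
    · exact ((hR.ne h).2.2 rfl).elim
    · exact Or.inr (hR.trans _ _ _ _ h h')
  case tri =>
    intro a b h h'
    by_contra hab
    unfold cutAt at h h'
    have := hR.total z a b
    have := hR.total z b a
    grind

/-- Closing up undoes cutting. Only the forward implication needs work: by totality and asymmetry it
forces the converse. -/
theorem eq_cyc_cutAt {R : X → X → X → Prop} (hR : IsCircularOrder R) (z a b c : X) :
    R a b c ↔ cyc (cutAt R z) a b c := by
  have h0 := isStrictTotalOrder_cutAt hR z
  have key : ∀ a b c, R a b c → cyc (cutAt R z) a b c := by
    intro a b c h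
    have cy := hR.cyclic
    obtain ⟨h1, h2, h3⟩ := hR.ne h
    by_cases ha : a = z
    · subst ha; exact Or.inl ⟨Or.inl ⟨rfl, h1.symm⟩, Or.inr h⟩
    by_cases hb : b = z
    · subst hb; exact Or.inr (Or.inl ⟨Or.inl ⟨rfl, h2.symm⟩, Or.inr (cy _ _ _ h)⟩)
    by_cases hc : c = z
    · subst hc; exact Or.inr (Or.inr ⟨Or.inl ⟨rfl, h3.symm⟩, Or.inr (cy _ _ _ (cy _ _ _ h))⟩)
    -- For points other than `z`: if `a <_z b` but not `b <_z c`, then `c <_z a`. Otherwise `a <_z c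
    -- <_z b`, and transitivity seen from `c` gives `[c, b, a]`. Applied to the three rotations,
    -- this leaves only the case where all three relations fail, which would be a cycle in `<_z`.
    have tr : ∀ {a b c}, R a b c → b ≠ z → c ≠ z → a ≠ z → R z a b → ¬ R z b c → R z c a := by
      intro a b c h hb hc ha h' h''
      obtain ⟨h1, h2, h3⟩ := hR.ne h
      rcases hR.total z b c (Ne.symm hb) h2 hc with g | g
      · exact (h'' g).elim
      by_contra hca
      have g2 : R z a c := (hR.total z c a (Ne.symm hc) h3 ha).resolve_left hca
      have e1 : R c z a := cy _ _ _ (cy _ _ _ g2)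
      have e2 : R c b z := cy _ _ _ g
      have e3 : R c b a := hR.trans _ _ _ _ e2 e1
      exact hR.asymm _ _ _ e3 (cy _ _ _ h)
    unfold cyc cutAt
    by_cases g1 : R z a b <;> by_cases g2 : R z b c <;> by_cases g3 : R z c a
    · tauto
    · tauto
    · tauto
    · exact (g3 (tr h hb hc ha g1 g2)).elim
    · tauto
    · exact (g1 (tr (cy _ _ _ h) hc ha hb g2 g3)).elim
    · exact (g2 (tr (cy _ _ _ (cy _ _ _ h)) ha hb hc g3 g1)).elim
    · exfalso
      have k1 := (hR.total z a b (Ne.symm ha) h1 hb).resolve_left g1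
      have k2 := (hR.total z b c (Ne.symm hb) h2 hc).resolve_left g2
      have k3 := (hR.total z c a (Ne.symm hc) h3 ha).resolve_left g3
      exact g3 (hR.trans _ _ _ _ k2 k1)
  refine ⟨key a b c, fun h => ?_⟩
  obtain ⟨h1, h2, h3⟩ := cyc_ne h
  rcases hR.total a b c h1 h2 h3 with g | g
  · exact g
  · have := isCircularOrder_cyc (r := cutAt R z)
    exact (this.asymm _ _ _ (key _ _ _ g) (cyc_rotate.1 (cyc_rotate.1 h))).elim

/-- The point `z` has to precede only `a` and `b`, not everything. Hence an order without a minimum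
can serve as the cut at `z` for a finite configuration. -/
theorem eq_cutAt_of_least [IsStrictTotalOrder X r] {z a b : X} (hza : a ≠ z → r z a)
    (hzb : b ≠ z → r z b) : r a b ↔ cutAt (cyc r) z a b := by
  have irr : ∀ a, ¬ r a a := irrefl_of r
  have as : ∀ {a b}, r a b → ¬ r b a := fun h => asymm_of r h
  unfold cutAt cyc
  by_cases ha : a = z
  · subst ha
    by_cases hb : b = a
    · subst hb; have := irr b; tauto
    · have := hzb hb; tauto
  · have := hza ha
    have : ¬ r b z := fun h => by
      by_cases hb : b = z
      · exact irr _ (hb ▸ h)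
      · exact as h (hzb hb)
    tauto

/-- This removes the circular order as independent data: everything about the class reduces to
finite linear orders. Finiteness supplies the least element at which to cut. -/
theorem isCompatible_iff [Finite X] (R : X → X → X → Prop) (r : X → X → Prop) :
    (IsCircularOrder R ∧ IsCompatible R r) ↔
      (IsStrictTotalOrder X r ∧ ∀ a b c, R a b c ↔ cyc r a b c) := by
  constructor
  · rintro ⟨hR, hX | ⟨z, hz⟩⟩
    · exact ⟨{ irrefl := isEmptyElim, trans := isEmptyElim, trichotomous := isEmptyElim },
        isEmptyElim⟩
    · obtain rfl : r = cutAt R z := by funext a b; exact propext (hz a b)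
      exact ⟨isStrictTotalOrder_cutAt hR z, eq_cyc_cutAt hR z⟩
  · rintro ⟨hr, h⟩
    obtain rfl : R = cyc r := by funext a b c; exact propext (h a b c)
    refine ⟨isCircularOrder_cyc, ?_⟩
    rcases isEmpty_or_nonempty X with hX | hX
    · exact Or.inl hX
    · classical
      let _ := linearOrderOfSTO r
      obtain ⟨z, hz⟩ := Finite.exists_min (id : X → X)
      exact Or.inr ⟨z, fun a b => eq_cutAt_of_least
        (fun ha => show z < a from lt_of_le_of_ne (hz a) (Ne.symm ha))
        (fun hb => show z < b from lt_of_le_of_ne (hz b) (Ne.symm hb))⟩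

end cyc

/-! ### Dense linear orders without endpoints -/

/-- A dense strict linear order without endpoints. -/
structure IsDenseUnbounded {X : Type*} (r : X → X → Prop) : Prop where
  sto : IsStrictTotalOrder X r
  dense : ∀ a b, r a b → ∃ c, r a c ∧ r c b
  left : ∀ a, ∃ b, r b a
  right : ∀ a, ∃ b, r a b

/-- Back-and-forth with the generic ideal of finite partial isomorphisms started at `p`. Since `p`
itself lies in the ideal, the limit isomorphism agrees with it. -/
theorem exists_orderIso_extending {α β : Type*} [LinearOrder α] [LinearOrder β]
    [Countable α] [DenselyOrdered α] [NoMinOrder α] [NoMaxOrder α]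
    [Nonempty α] [Countable β] [DenselyOrdered β] [NoMinOrder β] [NoMaxOrder β] [Nonempty β]
    (p : Order.PartialIso α β) :
    ∃ e : α ≃o β, ∀ x ∈ p.1, e x.1 = x.2 := by
  open Order Order.PartialIso in
  cases nonempty_encodable α
  cases nonempty_encodable β
  let to_cofinal : α ⊕ β → Cofinal (PartialIso α β) := fun p ↦
    Sum.recOn p (definedAtLeft β) (definedAtRight α)
  let our_ideal : Ideal (PartialIso α β) := idealOfCofinals p to_cofinal
  let F a := funOfIdeal a our_ideal (cofinal_meets_idealOfCofinals _ to_cofinal (Sum.inl a))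
  let G b := invOfIdeal b our_ideal (cofinal_meets_idealOfCofinals _ to_cofinal (Sum.inr b))
  refine ⟨OrderIso.ofCmpEqCmp (fun a ↦ (F a).val) (fun b ↦ (G b).val) fun a b ↦ ?_, ?_⟩
  · rcases (F a).prop with ⟨f, hf, ha⟩
    rcases (G b).prop with ⟨g, hg, hb⟩
    rcases our_ideal.directed _ hf _ hg with ⟨m, _, fm, gm⟩
    exact m.prop (a, _) (fm ha) (_, b) (gm hb)
  · rintro ⟨a, b⟩ hab
    rcases (F a).prop with ⟨f, hf, ha⟩
    rcases our_ideal.directed _ hf _ (mem_idealOfCofinals p to_cofinal) with ⟨m, _, fm, gm⟩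
    have := m.prop (a, _) (fm ha) (a, b) (gm hab)
    rw [cmp_self_eq_eq] at this
    exact (cmp_eq_eq_iff _ _).1 this.symm

/-- Cantor's theorem with a prescribed finite part of the isomorphism. -/
theorem IsDenseUnbounded.exists_equiv {α β : Type*} [Countable α] [Countable β] [Nonempty α]
    [Nonempty β] {r : α → α → Prop} {s : β → β → Prop} (hr : IsDenseUnbounded r)
    (hs : IsDenseUnbounded s) {ι : Type*} [Finite ι] (f : ι → α) (g : ι → β)
    (h : ∀ i j, r (f i) (f j) ↔ s (g i) (g j)) :
    ∃ e : α ≃ β, (∀ a b, r a b ↔ s (e a) (e b)) ∧ ∀ i, e (f i) = g i := by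
  classical
  have := hr.sto
  have := hs.sto
  let _ := linearOrderOfSTO r
  let _ := linearOrderOfSTO s
  have : DenselyOrdered α := ⟨fun a b => hr.dense a b⟩
  have : DenselyOrdered β := ⟨fun a b => hs.dense a b⟩
  have : NoMinOrder α := ⟨hr.left⟩
  have : NoMinOrder β := ⟨hs.left⟩
  have : NoMaxOrder α := ⟨hr.right⟩
  have : NoMaxOrder β := ⟨hs.right⟩
  cases nonempty_fintype ι
  have h' : ∀ i j, f i < f j ↔ g i < g j := h
  obtain ⟨e, he⟩ := exists_orderIso_extending (α := α) (β := β)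
    ⟨Finset.univ.image fun i => (f i, g i), by
      intro p hp q hq
      simp only [Finset.mem_image, Finset.mem_univ, true_and] at hp hq
      obtain ⟨i, rfl⟩ := hp
      obtain ⟨j, rfl⟩ := hq
      have h1 := h' i j
      have h2 := h' j i
      rcases lt_trichotomy (f i) (f j) with g1 | g1 | g1
      · rw [cmp_eq_lt_iff _ _ |>.2 g1, cmp_eq_lt_iff _ _ |>.2 (h1.1 g1)]
      · have : g i = g j := by
          rw [g1] at h1 h2
          simp only [lt_self_iff_false, false_iff, not_lt] at h1 h2
          exact le_antisymm h2 h1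
        rw [cmp_eq_eq_iff _ _ |>.2 g1, cmp_eq_eq_iff _ _ |>.2 this]
      · rw [cmp_eq_gt_iff _ _ |>.2 g1, cmp_eq_gt_iff _ _ |>.2 (h2.1 g1)]⟩
  refine ⟨e.toEquiv, fun a b => (e.lt_iff_lt (x := a) (y := b)).symm, fun i => ?_⟩
  exact he (f i, g i) (Finset.mem_image_of_mem _ (Finset.mem_univ i))

/-- Finite linear orders embed in nonempty dense ones. -/
theorem IsDenseUnbounded.exists_embedding {α β : Type*} [Finite α] [Nonempty β]
    {r : α → α → Prop} {s : β → β → Prop} [hr : IsStrictTotalOrder α r]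
    (hs : IsDenseUnbounded s) : ∃ f : α → β, ∀ a b, r a b ↔ s (f a) (f b) := by
  classical
  have := hs.sto
  let _ := linearOrderOfSTO r
  let _ := linearOrderOfSTO s
  have : DenselyOrdered β := ⟨fun a b => hs.dense a b⟩
  have : Nontrivial β := by
    obtain ⟨a⟩ := ‹Nonempty β›
    obtain ⟨b, hb⟩ := hs.left a
    exact ⟨b, a, fun h => irrefl_of s a (h ▸ hb)⟩
  obtain ⟨f⟩ := Order.embedding_from_countable_to_dense α β
  exact ⟨f, fun a b => f.lt_iff_lt.symm⟩

/-! ### Ramsey's theorem -/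

/-- Separate targets `p i` for the colours permit a double induction, on `m` and then on `∑ i, p i`,
in the style of Erdős and Szekeres: one target is lowered by one, and the missing point is put back
at the end. -/
theorem ramsey_vector (m k : ℕ) (p : Fin k → ℕ) : ∃ N : ℕ, ∀ (α : Type) (S : Finset α), N ≤ S.card →
    ∀ c : Finset α → Fin k, ∃ i, ∃ T ⊆ S, T.card = p i ∧ ∀ U ⊆ T, U.card = m → c U = i := by
  classical
  induction m generalizing p with
  | zero =>
    refine ⟨∑ i, p i, fun α S hS c => ⟨c ∅, ?_⟩⟩
    obtain ⟨T, hT, hT'⟩ := Finset.exists_subset_card_eq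
      ((Finset.single_le_sum (f := p) (by simp) (Finset.mem_univ (c ∅))).trans hS)
    exact ⟨T, hT, hT', fun U _ hU => by rw [Finset.card_eq_zero.1 hU]⟩
  | succ m ihm =>
    obtain ⟨n, hn⟩ : ∃ n, n = ∑ i, p i := ⟨_, rfl⟩
    induction n generalizing p with
    | zero =>
      -- All targets vanish, so the empty set will do; `c ∅` merely exhibits a colour.
      refine ⟨0, fun α S _ c => ⟨c ∅, ∅, by simp, ?_, fun U hU hc => ?_⟩⟩
      · have := Finset.single_le_sum (f := p) (by simp) (Finset.mem_univ (c ∅))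
        simp only [Finset.card_empty]; omega
      · rw [Finset.subset_empty.1 hU] at hc; simp at hc
    | succ n ihn =>
      by_cases h0 : ∃ i, p i = 0
      · obtain ⟨i, hi⟩ := h0
        refine ⟨0, fun α S _ c => ⟨i, ∅, by simp, by simp [hi], fun U hU hc => ?_⟩⟩
        rw [Finset.subset_empty.1 hU] at hc; simp at hc
      push Not at h0
      have hN : ∀ j, ∃ N : ℕ, ∀ (α : Type) (S : Finset α), N ≤ S.card → ∀ c : Finset α → Fin k,
          ∃ i, ∃ T ⊆ S, T.card = Function.update p j (p j - 1) i ∧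
            ∀ U ⊆ T, U.card = m + 1 → c U = i := by
        intro j
        apply ihn
        have h1 := Finset.sum_update_of_mem (Finset.mem_univ j) p (p j - 1)
        have h2 := Finset.sum_update_of_mem (Finset.mem_univ j) p (p j)
        rw [Function.update_eq_self] at h2
        have := h0 j
        omega
      choose N hN using hN
      obtain ⟨M, hM⟩ := ihm fun _ => ∑ j, N j
      refine ⟨M + 1, fun α S hS c => ?_⟩
      obtain ⟨x, hx⟩ : S.Nonempty := Finset.card_pos.1 (by omega)
      -- Colouring `m`-sets `U` by the colour of `insert x U` gives a large `T'` on which every `(m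
      -- + 1)`-set through `x` has colour `j`. Inside `T'` the target for `j` may be one too small,
      -- and then `x` completes it.
      obtain ⟨j, T', hT', hc', hj⟩ := hM α (S.erase x) (by rw [Finset.card_erase_of_mem hx]; omega)
        fun U => c (insert x U)
      obtain ⟨i, T, hT, hc, hi⟩ := hN j α T' (by
        rw [hc']; exact Finset.single_le_sum (by simp) (Finset.mem_univ j)) c
      have hTS := hT.trans hT'
      by_cases hij : i = j
      · subst hij
        have hxT : x ∉ T := fun h => Finset.notMem_erase x S (hTS h)
        refine ⟨i, insert x T, ?_, ?_, fun U hU hUc => ?_⟩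
        · exact Finset.insert_subset hx (hTS.trans (Finset.erase_subset _ _))
        · rw [Finset.card_insert_of_notMem hxT, hc, Function.update_self]
          have := h0 i
          omega
        · by_cases hxU : x ∈ U
          · rw [← Finset.insert_erase hxU]
            apply hj
            · intro y hy
              obtain ⟨hyx, hyU⟩ := Finset.mem_erase.1 hy
              exact hT ((Finset.mem_insert.1 (hU hyU)).resolve_left hyx)
            · rw [Finset.card_erase_of_mem hxU]; omega
          · exact hi U ((Finset.subset_insert_iff_of_notMem hxU).1 hU) hUc
      · exact ⟨i, T, hTS.trans (Finset.erase_subset _ _), by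
          rw [hc, Function.update_of_ne hij], hi⟩

/-- Ramsey's theorem for `k`-colourings of the `m`-element subsets of a finite set. -/
theorem exists_ramsey (m k n : ℕ) : ∃ N : ℕ, ∀ (α : Type) (S : Finset α), N ≤ S.card →
    ∀ c : Finset α → Fin k, ∃ i, ∃ T ⊆ S, T.card = n ∧ ∀ U ⊆ T, U.card = m → c U = i :=
  ramsey_vector m k fun _ => n

/-! ### Relational structures with a circular order and a linear order -/

instance : circLang.IsRelational := fun _ => inferInstanceAs (IsEmpty Empty)

instance : ltLang.IsRelational := fun _ => inferInstanceAs (IsEmpty Empty)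

/-- The interpretation of `[·,·,·]` in a structure of the language `{[·,·,·]}`. -/
def circRel (A : Type*) [circLang.Structure A] (a b c : A) : Prop :=
  Structure.RelMap (L := circLang) (M := A) (n := 3) CircRel.circ ![a, b, c]

section embeddings

variable {A B : Type*}

theorem vec_two_eq {n : Fin 2 → A} : n = ![n 0, n 1] := by
  funext i; fin_cases i <;> rfl

theorem vec_three_eq {n : Fin 3 → A} : n = ![n 0, n 1, n 2] := by
  funext i; fin_cases i <;> rfl

theorem comp_vec_two (f : A → B) (a b : A) : f ∘ ![a, b] = ![f a, f b] := by
  funext i; fin_cases i <;> rfl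

theorem comp_vec_three (f : A → B) (a b c : A) : f ∘ ![a, b, c] = ![f a, f b, f c] := by
  funext i; fin_cases i <;> rfl

/-- Injections preserving and reflecting the circular order are embeddings. -/
def circEmbedding [circLang.Structure A] [circLang.Structure B] (f : A ↪ B)
    (h : ∀ a b c, circRel A a b c ↔ circRel B (f a) (f b) (f c)) : A ↪[circLang] B where
  toEmbedding := f
  map_fun' := fun g => (g : Empty).elim
  map_rel' := by
    rintro _ ⟨⟩ x
    rw [vec_three_eq (n := x)]
    have := h (x 0) (x 1) (x 2)
    unfold circRel at this
    rw [this]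
    erw [comp_vec_three]
    rfl

/-- Bijections preserving and reflecting the circular order are isomorphisms. -/
def circEquiv [circLang.Structure A] [circLang.Structure B] (f : A ≃ B)
    (h : ∀ a b c, circRel A a b c ↔ circRel B (f a) (f b) (f c)) : A ≃[circLang] B where
  toEquiv := f
  map_fun' := fun g => (g : Empty).elim
  map_rel' := (circEmbedding f.toEmbedding h).map_rel'

theorem circRel_embedding [circLang.Structure A] [circLang.Structure B] (f : A ↪[circLang] B)
    (a b c : A) : circRel A a b c ↔ circRel B (f a) (f b) (f c) := by
  have := f.map_rel CircRel.circ ![a, b, c]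
  rw [comp_vec_three] at this
  exact this.symm

theorem circRel_equiv [circLang.Structure A] [circLang.Structure B] (f : A ≃[circLang] B)
    (a b c : A) : circRel A a b c ↔ circRel B (f a) (f b) (f c) :=
  circRel_embedding f.toEmbedding a b c

variable [(circLang.sum ltLang).Structure A] [(circLang.sum ltLang).Structure B]

/-- Injections preserving and reflecting both orders are embeddings. -/
def circLtEmbedding (f : A ↪ B) (h : ∀ a b c, circOf A a b c ↔ circOf B (f a) (f b) (f c))
    (h' : ∀ a b, ltOf circLang A a b ↔ ltOf circLang B (f a) (f b)) :
    A ↪[circLang.sum ltLang] B where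
  toEmbedding := f
  map_fun' := fun g => (g : Empty ⊕ Empty).elim Empty.elim Empty.elim
  map_rel' := by
    rintro _ (⟨⟨⟩⟩ | ⟨⟨⟩⟩) x
    · rw [vec_three_eq (n := x)]
      have := h (x 0) (x 1) (x 2)
      unfold circOf at this
      rw [this]
      erw [comp_vec_three]
      rfl
    · rw [vec_two_eq (n := x)]
      have := h' (x 0) (x 1)
      unfold ltOf at this
      rw [this]
      erw [comp_vec_two]
      rfl

/-- Bijections preserving and reflecting both orders are isomorphisms. -/
def circLtEquiv (f : A ≃ B) (h : ∀ a b c, circOf A a b c ↔ circOf B (f a) (f b) (f c))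
    (h' : ∀ a b, ltOf circLang A a b ↔ ltOf circLang B (f a) (f b)) :
    A ≃[circLang.sum ltLang] B where
  toEquiv := f
  map_fun' := fun g => (g : Empty ⊕ Empty).elim Empty.elim Empty.elim
  map_rel' := (circLtEmbedding f.toEmbedding h h').map_rel'

theorem circOf_embedding (f : A ↪[circLang.sum ltLang] B) (a b c : A) :
    circOf A a b c ↔ circOf B (f a) (f b) (f c) := by
  have := f.map_rel (n := 3) (Sum.inl CircRel.circ) ![a, b, c]
  rw [comp_vec_three] at this
  exact this.symm

theorem ltOf_embedding (f : A ↪[circLang.sum ltLang] B) (a b : A) :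
    ltOf circLang A a b ↔ ltOf circLang B (f a) (f b) := by
  have := f.map_rel (n := 2) (Sum.inr LtRel.lt) ![a, b]
  rw [comp_vec_two] at this
  exact this.symm

end embeddings

/-! ### The class of finite circular orders with a compatible linear order -/

theorem mem_circClass_iff {A : Bundled.{0} (circLang.sum ltLang).Structure} :
    A ∈ circClass ↔ Finite A ∧ IsStrictTotalOrder A (ltOf circLang A) ∧
      ∀ a b c, circOf A a b c ↔ cyc (ltOf circLang A) a b c := by
  refine and_congr_right fun hA => ?_
  exact isCompatible_iff _ _

theorem expansion_mem_iff {A : Type} [circLang.Structure A] {r : A → A → Prop} :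
    expansion (L₀ := circLang) A r ∈ circClass ↔ Finite A ∧ IsStrictTotalOrder A r ∧
      ∀ a b c, circRel A a b c ↔ cyc r a b c :=
  mem_circClass_iff (A := expansion (L₀ := circLang) A r)

theorem mem_circClass_of_embedding {A B : Bundled.{0} (circLang.sum ltLang).Structure}
    (hB : B ∈ circClass) (f : A ↪[circLang.sum ltLang] B) : A ∈ circClass := by
  rw [mem_circClass_iff] at hB ⊢
  obtain ⟨h1, h2, h3⟩ := hB
  refine ⟨Finite.of_injective f f.injective, ?_, fun a b c => ?_⟩
  · exact (⟨f.toEmbedding, (ltOf_embedding f _ _).symm⟩ : ltOf circLang A ↪r ltOf circLang B).isStrictTotalOrder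
  · rw [circOf_embedding f, h3]
    exact (cyc_congr f (ltOf_embedding f) a b c).symm

theorem exists_embedding_of_strictTotalOrder {X Y : Type*} [Finite X] [Finite Y]
    (r : X → X → Prop) (s : Y → Y → Prop) [IsStrictTotalOrder X r] [IsStrictTotalOrder Y s]
    (h : Nat.card X ≤ Nat.card Y) : ∃ f : X ↪ Y, ∀ a b, r a b ↔ s (f a) (f b) := by
  classical
  let _ := linearOrderOfSTO r
  let _ := linearOrderOfSTO s
  have := Fintype.ofFinite X
  have := Fintype.ofFinite Y
  let e := (Fintype.orderIsoFinOfCardEq X (Nat.card_eq_fintype_card (α := X)).symm)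
  let e' := (Fintype.orderIsoFinOfCardEq Y (Nat.card_eq_fintype_card (α := Y)).symm)
  let f : X ↪o Y := (e.symm.toOrderEmbedding.trans (Fin.castLEOrderEmb h)).trans
    e'.toOrderEmbedding
  exact ⟨f.toEmbedding, fun a b => f.lt_iff_lt.symm⟩

/-- An order embedding automatically respects the circular orders, since both are closures of linear
orders. So cardinality is the only obstruction. -/
theorem nonempty_embedding_of_card_le {A B : Bundled.{0} (circLang.sum ltLang).Structure}
    (hA : A ∈ circClass) (hB : B ∈ circClass) (h : Nat.card A ≤ Nat.card B) :
    Nonempty (A ↪[circLang.sum ltLang] B) := by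
  rw [mem_circClass_iff] at hA hB
  obtain ⟨h1, h2, h3⟩ := hA
  obtain ⟨g1, g2, g3⟩ := hB
  obtain ⟨f, hf⟩ := exists_embedding_of_strictTotalOrder (ltOf circLang A) (ltOf circLang B) h
  exact ⟨circLtEmbedding f (fun a b c => by rw [h3, g3]; exact cyc_congr f hf a b c) hf⟩

theorem nonempty_equiv_of_card_eq {A B : Bundled.{0} (circLang.sum ltLang).Structure}
    (hA : A ∈ circClass) (hB : B ∈ circClass) (h : Nat.card A = Nat.card B) :
    Nonempty (A ≃[circLang.sum ltLang] B) := by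
  obtain ⟨f⟩ := nonempty_embedding_of_card_le hA hB h.le
  have : Finite A := hA.1
  have : Finite B := hB.1
  have hf : Function.Bijective f := by
    have := Fintype.ofFinite A
    have := Fintype.ofFinite B
    rw [Fintype.bijective_iff_injective_and_card]
    exact ⟨f.injective, by simpa [Nat.card_eq_fintype_card] using h⟩
  exact ⟨circLtEquiv (Equiv.ofBijective f hf) (circOf_embedding f) (ltOf_embedding f)⟩

/-- The structure `{0, …, n - 1}` with its natural orders. -/
def finStructure (n : ℕ) : Bundled.{0} (circLang.sum ltLang).Structure :=
  letI : circLang.Structure (Fin n) := circStructure (cyc (· < ·))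
  expansion (L₀ := circLang) (Fin n) (· < ·)

theorem finStructure_mem (n : ℕ) : finStructure n ∈ circClass := by
  let _ : circLang.Structure (Fin n) := circStructure (cyc (· < ·))
  exact expansion_mem_iff.2 ⟨inferInstance, inferInstance, fun a b c => Iff.rfl⟩

theorem card_finStructure (n : ℕ) : Nat.card (finStructure n) = n :=
  Nat.card_fin n

/-- Every subset of a relational structure is a substructure. -/
def subsetSubstructure {L : FirstOrder.Language.{0, 0}} [L.IsRelational] {M : Type*} [L.Structure M]
    (s : Set M) : L.Substructure M :=
  ⟨s, fun f => isEmptyElim f⟩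

theorem substructure_mem {C : Bundled.{0} (circLang.sum ltLang).Structure} (hC : C ∈ circClass)
    (S : (circLang.sum ltLang).Substructure C) :
    (⟨S, inferInstance⟩ : Bundled.{0} (circLang.sum ltLang).Structure) ∈ circClass :=
  mem_circClass_of_embedding hC S.subtype

/-- Copies of `A` in a member of the class are exactly its subsets of size `Nat.card A`, so Ramsey's
theorem for subsets of `Fin N` applies directly. -/
theorem ramseyProperty_circClass : RamseyProperty circClass := by
  classical
  intro A hA B hB _ k hk
  obtain ⟨N, hN⟩ := exists_ramsey (Nat.card A) k (Nat.card B)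
  have hC := finStructure_mem N
  let sub : Finset (Fin N) → (circLang.sum ltLang).Substructure (finStructure N) :=
    fun U => subsetSubstructure (U : Set (Fin N))
  have card_sub : ∀ U, Nat.card (sub U) = U.card := fun U => by
    have : Nat.card (sub U) = Nat.card (U : Set (Fin N)) := rfl
    simp [this]
  have key : ∀ c : Finset (Fin N) → Fin k, ∃ i, ∃ T : Finset (Fin N), T.card = Nat.card B ∧
      ∀ U ⊆ T, U.card = Nat.card A → c U = i := fun c => by
    obtain ⟨i, T, -, h⟩ := hN (Fin N) Finset.univ (by simp) c
    exact ⟨i, T, h⟩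
  refine ⟨finStructure N, hC, ?_, fun c => ?_⟩
  · obtain ⟨-, T, hT, -⟩ := key fun _ => ⟨0, by omega⟩
    refine nonempty_embedding_of_card_le hB hC ?_
    rw [card_finStructure, ← hT]
    simpa using Finset.card_le_univ T
  · obtain ⟨i, T, hT, hi⟩ := key fun U =>
      if h : Nonempty (A ≃[circLang.sum ltLang] sub U) then c ⟨sub U, h⟩ else ⟨0, by omega⟩
    refine ⟨sub T, nonempty_equiv_of_card_eq hB (substructure_mem hC _) (by
      rw [← hT]; exact (card_sub T).symm), i, ?_⟩
    rintro ⟨A', ⟨e⟩⟩ hA'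
    obtain ⟨U, rfl⟩ : ∃ U, sub U = A' :=
      ⟨(Set.toFinite (α := Fin N) A'.carrier).toFinset, SetLike.coe_injective (Set.Finite.coe_toFinset _)⟩
    have h1 : U.card = Nat.card A := by rw [← card_sub, Nat.card_congr e.toEquiv]
    have h2 := hi U (fun x hx => hA' (show x ∈ sub U from hx)) h1
    rw [dif_pos ⟨e⟩] at h2
    exact h2

/-- Any two compatible orders on the same set give isomorphic structures, because their
cardinalities agree. -/
theorem orderingProperty_circClass : OrderingProperty circClass := by
  intro A₀ hA
  exact ⟨A₀, hA, fun r r' _ _ h h' => nonempty_embedding_of_card_le h h' le_rfl⟩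

/-- If `r` is the cut at `z`, the cut of `B₀` at `π z` extends it. An empty `A₀` imposes no
condition, and any compatible order on `B₀` works. -/
theorem isReasonable_circClass : IsReasonable circClass := by
  rintro A₀ - B₀ ⟨s, hs⟩ π r hr hA
  have hs' := expansion_mem_iff.1 hs
  obtain ⟨hfin, hsto, hcyc⟩ := hs'
  rcases hA.2.2 with hE | ⟨z, hz⟩
  · have hE' : IsEmpty A₀ := hE
    exact ⟨s, hsto, hs, isEmptyElim⟩
  · have hB : IsCircularOrder (circRel B₀) := hs.2.1
    have h' : expansion (L₀ := circLang) B₀ (cutAt (circRel B₀) (π z)) ∈ circClass :=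
      ⟨hfin, hB, Or.inr ⟨π z, fun _ _ => Iff.rfl⟩⟩
    refine ⟨_, (expansion_mem_iff.1 h').2.1, h', fun a b => (hz a b).trans ?_⟩
    have h1 := circRel_embedding π z a b
    refine or_congr (and_congr π.injective.eq_iff.symm (not_congr π.injective.eq_iff.symm)) h1

/-! ### Fraïssé limits -/

/-- Cantor's theorem extends finite partial isomorphisms of the linear order, and the circular order
follows along. -/
theorem isFraisseLimit_circClass (M : Type) [Countable M] [Nonempty M]
    [(circLang.sum ltLang).Structure M] (hd : IsDenseUnbounded (ltOf circLang M))
    (hc : ∀ a b c, circOf M a b c ↔ cyc (ltOf circLang M) a b c) :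
    IsFraisseLimit circClass M where
  ultrahomogeneous := by
    intro S hS f
    have := Substructure.FG.finite hS
    obtain ⟨e, he, he'⟩ := hd.exists_equiv hd (fun x : S => (x : M)) f fun x y => by
      exact (ltOf_embedding S.subtype x y).symm.trans (ltOf_embedding f x y)
    refine ⟨circLtEquiv e (fun a b c => ?_) he, ?_⟩
    · rw [hc, hc]; exact cyc_congr e he a b c
    · ext x
      exact (he' x).symm
  age := by
    ext N
    constructor
    · rintro ⟨h, ⟨f⟩⟩
      have := Structure.FG.finite h
      have hsto := hd.sto
      refine mem_circClass_iff.2 ⟨this, ?_, fun a b c => ?_⟩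
      · exact (⟨f.toEmbedding, (ltOf_embedding f _ _).symm⟩ :
          ltOf circLang N ↪r ltOf circLang M).isStrictTotalOrder
      · rw [circOf_embedding f, hc]
        exact (cyc_congr f (ltOf_embedding f) a b c).symm
    · intro hN
      obtain ⟨h1, h2, h3⟩ := mem_circClass_iff.1 hN
      refine ⟨Structure.FG.of_finite, ?_⟩
      obtain ⟨f, hf⟩ := hd.exists_embedding (α := N) (r := ltOf circLang N)
      have hinj : Function.Injective f := fun a b hab => by
        rcases trichotomous_of (ltOf circLang N) a b with h | h | h
        · rw [hf, hab] at h; exact (hd.sto.irrefl _ h).elim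
        · exact h
        · rw [hf, hab] at h; exact (hd.sto.irrefl _ h).elim
      exact ⟨circLtEmbedding ⟨f, hinj⟩ (fun a b c => by
        rw [h3, hc]; exact cyc_congr f hf a b c) hf⟩

/-- Amalgamation is not checked by hand: the class is the age of the ultrahomogeneous structure
carried by `ℚ`. -/
theorem isFraisseOrderClass_circClass : IsFraisseOrderClass circClass where
  isFraisse := by
    let _ : circLang.Structure ℚ := circStructure (cyc (· < ·))
    let _ := expansionStructure (L₀ := circLang) ℚ (· < ·)
    exact (isFraisseLimit_circClass ℚ ⟨inferInstanceAs (IsStrictTotalOrder ℚ (· < ·)),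
      fun a b h => exists_between (α := ℚ) h, exists_lt (α := ℚ), exists_gt (α := ℚ)⟩
      fun a b c => Iff.rfl).isFraisse
  finite A hA := hA.1
  unbounded n := ⟨finStructure n, finStructure_mem n, (card_finStructure n).ge⟩
  linear A hA := (mem_circClass_iff.1 hA).2.1

/-! ### Homogeneity of circular orders with dense cuts -/

/-- A circular order on `M` which can be cut immediately before any point `z`, relative to a given
finite set, to give a dense linear order without endpoints. -/
def HasDenseCuts {M : Type*} (R : M → M → M → Prop) : Prop :=
  ∀ (T : Set M) (z : M), T.Finite → ∃ r : M → M → Prop, IsDenseUnbounded r ∧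
    (∀ a b c, R a b c ↔ cyc r a b c) ∧ ∀ w ∈ T, w ≠ z → r z w

/-- Cut just before `f i₀` and just before `g i₀`. On the two finite configurations these orders are
the cuts at `f i₀` and `g i₀`, which are defined by `R` and hence correspond; Cantor's theorem then
extends the correspondence to an isomorphism of the two dense orders, which preserves `R`. -/
theorem HasDenseCuts.exists_equiv {M : Type*} [Countable M] {R : M → M → M → Prop}
    (hR : HasDenseCuts R) {ι : Type*} [Finite ι] (f g : ι → M)
    (hinj : ∀ i j, f i = f j ↔ g i = g j)
    (h : ∀ i j k, R (f i) (f j) (f k) ↔ R (g i) (g j) (g k)) :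
    ∃ e : M ≃ M, (∀ a b c, R a b c ↔ R (e a) (e b) (e c)) ∧ ∀ i, e (f i) = g i := by
  rcases isEmpty_or_nonempty ι with hι | ⟨⟨i₀⟩⟩
  · exact ⟨Equiv.refl M, fun _ _ _ => Iff.rfl, isEmptyElim⟩
  have : Nonempty M := ⟨f i₀⟩
  obtain ⟨r, hr, hr', hr''⟩ := hR (Set.range f) (f i₀) (Set.finite_range f)
  obtain ⟨s, hs, hs', hs''⟩ := hR (Set.range g) (g i₀) (Set.finite_range g)
  have := hr.sto
  have := hs.sto
  obtain ⟨e, he, he'⟩ := hr.exists_equiv hs f g fun i j => by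
    rw [eq_cutAt_of_least (hr'' _ ⟨i, rfl⟩) (hr'' _ ⟨j, rfl⟩),
      eq_cutAt_of_least (hs'' _ ⟨i, rfl⟩) (hs'' _ ⟨j, rfl⟩)]
    unfold cutAt
    rw [← hr', ← hs', hinj, h, Ne, hinj]
  exact ⟨e, fun a b c => by rw [hr', hs']; exact cyc_congr e he a b c, he'⟩

theorem isFraisseLimit_reductClass (M : Type) [Countable M] [Nonempty M]
    [circLang.Structure M] (hR : HasDenseCuts (circRel M)) :
    IsFraisseLimit (reductClass circClass) M where
  ultrahomogeneous := by
    intro S hS f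
    have := Substructure.FG.finite hS
    obtain ⟨e, he, he'⟩ := hR.exists_equiv (fun x : S => (x : M)) f
      (fun i j => by rw [f.injective.eq_iff, Subtype.coe_injective.eq_iff]) fun x y z => by
        exact (circRel_embedding S.subtype x y z).symm.trans (circRel_embedding f x y z)
    refine ⟨circEquiv e he, ?_⟩
    ext x
    exact (he' x).symm
  age := by
    -- Any dense cut expands `M` to the limit of the larger class, whose age is already known.
    obtain ⟨r, hr, hc, -⟩ := hR ∅ (Classical.arbitrary M) Set.finite_empty
    let _ := expansionStructure (L₀ := circLang) M r
    have hM := (isFraisseLimit_circClass M hr hc).age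
    ext N
    constructor
    · rintro ⟨h, ⟨f⟩⟩
      refine ⟨fun a b => r (f a) (f b), ?_⟩
      rw [← hM]
      have := Structure.FG.finite h
      have : Finite (expansion (L₀ := circLang) N fun a b => r (f a) (f b)) := this
      exact ⟨Structure.FG.of_finite, ⟨circLtEmbedding f.toEmbedding (circRel_embedding f)
        fun a b => Iff.rfl⟩⟩
    · rintro ⟨s, hs⟩
      have hN := hs
      rw [← hM] at hs
      obtain ⟨-, ⟨f⟩⟩ := hs
      have : Finite N := hN.1
      exact ⟨Structure.FG.of_finite, ⟨circEmbedding f.toEmbedding (circOf_embedding f)⟩⟩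

/-! ### The circle -/

/-- The representative of a point of the circle in `[α, α + 1)`. -/
noncomputable def rep (α : ℝ) (x : UnitAddCircle) : ℝ := AddCircle.equivIco 1 α x

theorem rep_mem (α : ℝ) (x : UnitAddCircle) : rep α x ∈ Set.Ico α (α + 1) :=
  (AddCircle.equivIco 1 α x).2

theorem coe_rep (α : ℝ) (x : UnitAddCircle) : ((rep α x : ℝ) : UnitAddCircle) = x :=
  (AddCircle.equivIco 1 α).symm_apply_apply x

theorem rep_injective (α : ℝ) : Function.Injective (rep α) := fun x y h => by
  rw [← coe_rep α x, h, coe_rep]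

theorem rep_coe {α a : ℝ} (ha : a ∈ Set.Ico α (α + 1)) : rep α (a : UnitAddCircle) = a :=
  (AddCircle.coe_eq_coe_iff_of_mem_Ico (rep_mem _ _) ha).1 (coe_rep _ _)

/-- Betweenness on the quotient is tested with representatives in a window based at `c`. Moving from
the common window `[α, α + 1)` to that one shifts `a` and `b` by `0` or `1`, which leaves a finite
comparison. -/
theorem sbtw_coe_iff {α a b c : ℝ} (ha : a ∈ Set.Ico α (α + 1)) (hb : b ∈ Set.Ico α (α + 1))
    (hc : c ∈ Set.Ico α (α + 1)) :
    sbtw (a : UnitAddCircle) b c ↔ cyc (· < ·) a b c := by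
  rw [sbtw_iff_not_btw]
  have h1 : btw (c : UnitAddCircle) b a ↔
      toIcoMod zero_lt_one c b ≤ toIocMod zero_lt_one c a := QuotientAddGroup.btw_coe_iff
  rw [h1]
  have h2 : toIcoMod zero_lt_one c b = if c ≤ b then b else b + 1 := by
    rw [toIcoMod_eq_iff]
    obtain ⟨b1, b2⟩ := hb
    obtain ⟨c1, c2⟩ := hc
    split_ifs with h
    · exact ⟨⟨h, by linarith⟩, 0, by simp⟩
    · exact ⟨⟨by linarith, by linarith⟩, -1, by simp⟩
  have h3 : toIocMod zero_lt_one c a = if c < a then a else a + 1 := by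
    rw [toIocMod_eq_iff]
    obtain ⟨b1, b2⟩ := ha
    obtain ⟨c1, c2⟩ := hc
    split_ifs with h
    · exact ⟨⟨h, by linarith⟩, 0, by simp⟩
    · exact ⟨⟨by linarith, by linarith⟩, -1, by simp⟩
  rw [h2, h3]
  obtain ⟨a1, a2⟩ := ha
  obtain ⟨b1, b2⟩ := hb
  obtain ⟨c1, c2⟩ := hc
  unfold cyc
  split_ifs <;> grind

theorem sbtw_iff_rep (α : ℝ) (x y z : UnitAddCircle) :
    sbtw x y z ↔ cyc (· < ·) (rep α x) (rep α y) (rep α z) := by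
  rw [← sbtw_coe_iff (rep_mem α x) (rep_mem α y) (rep_mem α z), coe_rep, coe_rep, coe_rep]

theorem rational_mem (q : ℚ) : ((q : ℝ) : UnitAddCircle) ∈ rationalPoints := ⟨q, rfl⟩

theorem not_irrational_of_mem {a : ℝ} (h : (a : UnitAddCircle) ∈ rationalPoints) :
    ¬ Irrational a := by
  obtain ⟨q, hq⟩ := h
  rw [← sub_eq_zero, ← AddCircle.coe_sub, AddCircle.coe_eq_zero_iff] at hq
  obtain ⟨n, hn⟩ := hq
  rintro hirr
  refine hirr ⟨q - n, ?_⟩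
  push_cast
  rw [zsmul_eq_mul, mul_one] at hn
  linarith

theorem rep_ne {α : ℝ} (hα : Irrational α) (q : rationalPoints) : rep α q ≠ α := fun h =>
  not_irrational_of_mem (a := α) (by rw [← h, coe_rep]; exact q.2) hα

theorem cutOrder_iff {α : ℝ} (hα : Irrational α) (x y : rationalPoints) :
    cutOrder α x y ↔ rep α x < rep α y := by
  constructor
  · rintro ⟨s, t, h1, h2, h3, h4, h5⟩
    rwa [← h4, ← h5, rep_coe ⟨h1.le, h2.trans h3⟩, rep_coe ⟨(h1.trans h2).le, h3⟩]
  · intro h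
    exact ⟨rep α x, rep α y, lt_of_le_of_ne (rep_mem α x).1 (rep_ne hα x).symm, h, (rep_mem α y).2,
      coe_rep _ _, coe_rep _ _⟩

theorem isDenseUnbounded_cutOrder {α : ℝ} (hα : Irrational α) :
    IsDenseUnbounded (cutOrder α) := by
  have key : ∀ a b : ℝ, α ≤ a → a < b → b ≤ α + 1 →
      ∃ q : rationalPoints, a < rep α q ∧ rep α q < b := fun a b h1 h2 h3 => by
    obtain ⟨q, hq, hq'⟩ := exists_rat_btwn h2
    refine ⟨⟨_, rational_mem q⟩, ?_⟩
    rw [rep_coe ⟨h1.trans hq.le, hq'.trans_le h3⟩]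
    exact ⟨hq, hq'⟩
  have hlt : ∀ x : rationalPoints, α < rep α x := fun x =>
    lt_of_le_of_ne (rep_mem α x).1 (rep_ne hα x).symm
  have hlt' : ∀ x : rationalPoints, rep α x < α + 1 := fun x => (rep_mem α x).2
  have hf : ∀ a b : rationalPoints, rep α a < rep α b ↔ cutOrder α a b := fun a b =>
    (cutOrder_iff hα a b).symm
  refine ⟨?_, fun a b h => ?_, fun a => ?_, fun a => ?_⟩
  · exact (⟨⟨fun q : rationalPoints => rep α q,
      (rep_injective α).comp Subtype.coe_injective⟩, hf _ _⟩ :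
        cutOrder α ↪r ((· < ·) : ℝ → ℝ → Prop)).isStrictTotalOrder
  · simp only [← hf] at h ⊢
    exact key _ _ (hlt a).le h (hlt' b).le
  · simp only [← hf]
    obtain ⟨q, -, hq⟩ := key _ _ le_rfl (hlt a) (hlt' a).le
    exact ⟨q, hq⟩
  · simp only [← hf]
    obtain ⟨q, hq, -⟩ := key _ _ (hlt a).le (hlt' a) le_rfl
    exact ⟨q, hq⟩

theorem circRel_iff_cyc_cutOrder {α : ℝ} (hα : Irrational α) (a b c : rationalPoints) :
    circRel rationalPoints a b c ↔ cyc (cutOrder α) a b c :=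
  (sbtw_iff_rep α a b c).trans
    (cyc_congr (r := cutOrder α) (fun q : rationalPoints => rep α q) (cutOrder_iff hα) a b c).symm

/-- Represent `z` by `ζ` and each `w ∈ T` in `[ζ - 1, ζ)`. An irrational `β < ζ` above these
finitely many representatives makes `ζ` come first in `(β, β + 1)`: the other points reappear,
shifted by one, to its right. -/
theorem hasDenseCuts_rationalPoints : HasDenseCuts (circRel rationalPoints) := by
  intro T z hT
  let ζ := rep 0 z
  have hζ : ((ζ : ℝ) : UnitAddCircle) = z := coe_rep 0 _
  have h1 : ∀ᶠ β in nhdsWithin ζ (Set.Iio ζ), ∀ w ∈ T, rep (ζ - 1) w < β := by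
    rw [Filter.eventually_all_finite hT]
    intro w _
    have := (rep_mem (ζ - 1) w).2
    rw [sub_add_cancel] at this
    exact Filter.eventually_of_mem (Ioo_mem_nhdsLT this) fun β hβ => hβ.1
  rw [Filter.eventually_iff, mem_nhdsLT_iff_exists_Ioo_subset] at h1
  obtain ⟨l, hl, hl'⟩ := h1
  obtain ⟨β, hβ, hβ1, hβ2⟩ := exists_irrational_btwn (max_lt hl (sub_one_lt ζ))
  refine ⟨cutOrder β, isDenseUnbounded_cutOrder hβ, circRel_iff_cyc_cutOrder hβ,
    fun w hw hwz => ⟨ζ, rep (ζ - 1) w + 1, hβ2, ?_, ?_, hζ, ?_⟩⟩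
  · have h2 := (rep_mem (ζ - 1) w).1
    have h3 : rep (ζ - 1) w ≠ ζ - 1 := fun h => hwz (by
      apply Subtype.ext
      rw [← coe_rep (ζ - 1) w, h, ← hζ, AddCircle.coe_sub, AddCircle.coe_period, sub_zero])
    have := lt_of_le_of_ne h2 h3.symm
    linarith
  · have := hl' ⟨(le_max_left _ _).trans_lt hβ1, hβ2⟩ w hw
    linarith
  · rw [AddCircle.coe_add, AddCircle.coe_period, add_zero, coe_rep]

instance : Nonempty rationalPoints := ⟨⟨_, rational_mem 0⟩⟩

open Topology Filter Uniformity

/-! ### The space of admissible orders -/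

section

variable {M : Type} [circLang.Structure M]

/-- The circular order is ternary and every subset is a substructure, so substructures on three
points already decide admissibility. -/
theorem isAdmissible_iff {r : M → M → Prop} :
    IsAdmissible circClass M r ↔ IsStrictTotalOrder M r ∧
      ∀ a b c, circRel M a b c ↔ cyc r a b c := by
  refine and_congr_right fun hr => ⟨fun h a b c => ?_, fun h S hS => ?_⟩
  · let S : circLang.Substructure M := subsetSubstructure {a, b, c}
    have hS : Finite S := (Set.toFinite {a, b, c} : ({a, b, c} : Set M).Finite)
    have ha : a ∈ S := Or.inl rfl
    have hb : b ∈ S := Or.inr (Or.inl rfl)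
    have hc : c ∈ S := Or.inr (Or.inr rfl)
    have h1 := (expansion_mem_iff.1 (h S hS)).2.2 ⟨a, ha⟩ ⟨b, hb⟩ ⟨c, hc⟩
    exact (circRel_embedding S.subtype ⟨a, ha⟩ ⟨b, hb⟩ ⟨c, hc⟩).symm.trans h1
  · refine expansion_mem_iff.2 ⟨hS, ?_, fun a b c => ?_⟩
    · exact (⟨⟨Subtype.val, Subtype.coe_injective⟩, Iff.rfl⟩ :
        (fun a b : S => r a b) ↪r r).isStrictTotalOrder
    · exact (circRel_embedding S.subtype a b c).trans (h a b c)

theorem AdmissibleOrders.sto (x : AdmissibleOrders circClass M) :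
    IsStrictTotalOrder M fun a b => x.1 a b = true :=
  (isAdmissible_iff.1 x.2).1

theorem AdmissibleOrders.circRel_iff (x : AdmissibleOrders circClass M) (a b c : M) :
    circRel M a b c ↔ cyc (fun a b => x.1 a b = true) a b c :=
  (isAdmissible_iff.1 x.2).2 a b c

/-- A linear order inducing the circular order of `M`, as a point of the space of admissible
orders. -/
noncomputable def AdmissibleOrders.of (r : M → M → Prop) (h : IsStrictTotalOrder M r)
    (h' : ∀ a b c, circRel M a b c ↔ cyc r a b c) : AdmissibleOrders circClass M :=
  ⟨fun a b => @decide (r a b) (Classical.dec _), by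
    simpa only [decide_eq_true_eq] using isAdmissible_iff.2 ⟨h, h'⟩⟩

theorem AdmissibleOrders.of_iff {r : M → M → Prop} {h : IsStrictTotalOrder M r}
    {h' : ∀ a b c, circRel M a b c ↔ cyc r a b c} {a b : M} :
    (AdmissibleOrders.of r h h').1 a b = true ↔ r a b := by
  unfold AdmissibleOrders.of
  simp

theorem AdmissibleOrders.ext_iff_true {x y : AdmissibleOrders circClass M} :
    x = y ↔ ∀ a b, x.1 a b = true ↔ y.1 a b = true := by
  refine ⟨fun h a b => by rw [h], fun h => Subtype.ext ?_⟩
  funext a b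
  exact Bool.eq_iff_iff.2 (h a b)

theorem mem_autGroup_iff {g : Equiv.Perm M} :
    g ∈ autGroup circLang M ↔ ∀ a b c, circRel M a b c ↔ circRel M (g a) (g b) (g c) := by
  constructor
  · rintro ⟨e, rfl⟩ a b c
    exact circRel_equiv e a b c
  · intro h
    exact ⟨circEquiv g h, rfl⟩

theorem AdmissibleOrders.smul_apply (g : autGroup circLang M) (x : AdmissibleOrders circClass M)
    (a b : M) : (g • x).1 a b = x.1 (g⁻¹.1 a) (g⁻¹.1 b) := rfl

theorem autGroup_inv_apply (g : autGroup circLang M) (a : M) : g⁻¹.1 (g.1 a) = a :=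
  g.1.symm_apply_apply a

theorem autGroup_apply_inv (g : autGroup circLang M) (a : M) : g.1 (g⁻¹.1 a) = a :=
  g.1.apply_symm_apply a

theorem AdmissibleOrders.isInducing_val :
    IsInducing fun x : AdmissibleOrders circClass M => x.1 := ⟨rfl⟩

theorem AdmissibleOrders.continuous_apply (a b : M) :
    Continuous fun x : AdmissibleOrders circClass M => x.1 a b :=
  (_root_.continuous_apply b).comp
    ((_root_.continuous_apply a).comp AdmissibleOrders.isInducing_val.continuous)

instance : T2Space (AdmissibleOrders circClass M) :=
  inferInstanceAs (T2Space {r : M → M → Bool // IsAdmissible circClass M fun a b => r a b = true})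

/-- By `isAdmissible_iff`, admissibility is a conjunction of conditions each involving finitely many
values of `r`. It therefore cuts out a closed subset of a product of two-point spaces. -/
instance : CompactSpace (AdmissibleOrders circClass M) := by
  suffices h : IsClosed {r : M → M → Bool | IsAdmissible circClass M fun a b => r a b = true} from
    isCompact_iff_compactSpace.1 h.isCompact
  have hop : ∀ a b, IsClopen {r : M → M → Bool | r a b = true} := fun a b =>
    (isClopen_discrete {true}).preimage ((_root_.continuous_apply b).comp (_root_.continuous_apply a))
  have himp : ∀ {p q : (M → M → Bool) → Prop}, IsClopen {r | p r} → IsClopen {r | q r} →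
      IsClopen {r | p r → q r} := fun hp hq => by
    convert hp.compl.union hq using 1
    ext r
    exact imp_iff_not_or
  have hand : ∀ {p q : (M → M → Bool) → Prop}, IsClopen {r | p r} → IsClopen {r | q r} →
      IsClopen {r | p r ∧ q r} := fun hp hq => hp.inter hq
  have hor : ∀ {p q : (M → M → Bool) → Prop}, IsClopen {r | p r} → IsClopen {r | q r} →
      IsClopen {r | p r ∨ q r} := fun hp hq => hp.union hq
  have hconst : ∀ p : Prop, IsClopen {_r : M → M → Bool | p} := fun p => by
    by_cases h : p <;> simp [h, isClopen_univ, isClopen_empty]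
  have heq : {r : M → M → Bool | IsAdmissible circClass M fun a b => r a b = true} =
      ((⋂ a, {r | r a a = true → False}) ∩
        (⋂ a, ⋂ b, ⋂ c, {r | r a b = true → r b c = true → r a c = true}) ∩
        (⋂ a, ⋂ b, {r | (r a b = true → False) → (r b a = true → False) → a = b})) ∩
        (⋂ a, ⋂ b, ⋂ c, {r | (circRel M a b c → cyc (fun a b => r a b = true) a b c) ∧
          (cyc (fun a b => r a b = true) a b c → circRel M a b c)}) := by
    ext r
    simp only [Set.mem_ofPred_eq, isAdmissible_iff, Set.mem_inter_iff, Set.mem_iInter]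
    constructor
    · rintro ⟨h, h'⟩
      exact ⟨⟨⟨h.irrefl, h.trans⟩, h.trichotomous⟩, fun a b c => ⟨(h' a b c).1, (h' a b c).2⟩⟩
    · rintro ⟨⟨⟨h1, h2⟩, h3⟩, h4⟩
      exact ⟨{ irrefl := h1, trans := h2, trichotomous := h3 }, fun a b c =>
        ⟨(h4 a b c).1, (h4 a b c).2⟩⟩
  rw [heq]
  have hcyc : ∀ a b c, IsClopen {r : M → M → Bool | cyc (fun a b => r a b = true) a b c} :=
    fun a b c => hor (hand (hop _ _) (hop _ _))
      (hor (hand (hop _ _) (hop _ _)) (hand (hop _ _) (hop _ _)))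
  refine (((isClosed_iInter fun a => (himp (hop _ _) (hconst _)).1).inter
    (isClosed_iInter fun a => isClosed_iInter fun b => isClosed_iInter fun c =>
      (himp (hop _ _) (himp (hop _ _) (hop _ _))).1)).inter
    (isClosed_iInter fun a => isClosed_iInter fun b =>
      (himp (himp (hop _ _) (hconst _)) (himp (himp (hop _ _) (hconst _)) (hconst _))).1)).inter
    (isClosed_iInter fun a => isClosed_iInter fun b => isClosed_iInter fun c =>
      (hand (himp (hconst _) (hcyc _ _ _)) (himp (hcyc _ _ _) (hconst _))).1)

theorem isOpen_autGroup_eval (a b : M) : IsOpen {g : autGroup circLang M | g.1 a = b} := by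
  have h : Continuous[_, ⊥] fun g : autGroup circLang M => g.1 a :=
    continuous_iff_le_induced.2 (iInf_le _ a)
  exact @IsOpen.preimage _ _ _ ⊥ _ h {b} trivial

theorem exists_finite_of_mem_nhds_one {U : Set (autGroup circLang M)} (hU : U ∈ 𝓝 1) :
    ∃ F : Finset M, ∀ g : autGroup circLang M, (∀ a ∈ F, g.1 a = a) → g ∈ U := by
  classical
  rw [nhds_iInf] at hU
  simp only [@nhds_induced _ _ ⊥, @nhds_discrete _ ⊥ ⟨rfl⟩] at hU
  rw [mem_iInf_finite] at hU
  obtain ⟨F, hF⟩ := hU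
  refine ⟨F, fun g hg => ?_⟩
  have h1 : (pure g : Filter _) ≤ ⨅ i ∈ F, comap (fun g : autGroup circLang M => g.1 i)
      (pure ((1 : autGroup circLang M).1 i)) := by
    refine le_iInf₂ fun i hi => ?_
    rw [← map_le_iff_le_comap, map_pure, hg i hi]
    exact le_rfl
  exact h1 hF

theorem finite_agreement_mem_nhds (x : AdmissibleOrders circClass M) (F : Finset M) :
    {y : AdmissibleOrders circClass M | ∀ a ∈ F, ∀ b ∈ F, y.1 a b = x.1 a b} ∈ 𝓝 x := by
  have : {y : AdmissibleOrders circClass M | ∀ a ∈ F, ∀ b ∈ F, y.1 a b = x.1 a b} =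
      ⋂ a ∈ F, ⋂ b ∈ F, {y | y.1 a b = x.1 a b} := by
    ext y; simp
  rw [this]
  refine (biInter_finset_mem F).2 fun a _ => (biInter_finset_mem F).2 fun b _ => ?_
  have h : {x.1 a b} ∈ 𝓝 (x.1 a b) := mem_nhds_discrete.2 rfl
  exact (AdmissibleOrders.continuous_apply a b).continuousAt.preimage_mem_nhds h

theorem exists_finite_of_mem_nhds {x : AdmissibleOrders circClass M}
    {U : Set (AdmissibleOrders circClass M)} (hU : U ∈ 𝓝 x) :
    ∃ F : Finset M, ∀ y : AdmissibleOrders circClass M,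
      (∀ a ∈ F, ∀ b ∈ F, y.1 a b = x.1 a b) → y ∈ U := by
  classical
  have hU' : U ∈ comap (fun x : AdmissibleOrders circClass M => x.1) (𝓝 x.1) := by
    have := AdmissibleOrders.isInducing_val.nhds_eq_comap x
    rw [this] at hU
    exact hU
  obtain ⟨V, hV, hVU⟩ := hU'
  rw [nhds_pi, mem_pi] at hV
  obtain ⟨I, hI, t, ht, htV⟩ := hV
  have h1 : ∀ a, ∃ J : Finset M, ∀ f : M → Bool, (∀ b ∈ J, f b = x.1 a b) → f ∈ t a := fun a => by
    have h2 := ht a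
    rw [nhds_pi, mem_pi] at h2
    obtain ⟨J, hJ, s, hs, hst⟩ := h2
    refine ⟨hJ.toFinset, fun f hf => hst fun b hb => ?_⟩
    rw [hf b (hJ.mem_toFinset.2 hb)]
    exact mem_of_mem_nhds (hs b)
  choose J hJ using h1
  refine ⟨hI.toFinset ∪ hI.toFinset.biUnion J, fun y hy => hVU (htV fun a ha => hJ a _ fun b hb => ?_)⟩
  have ha' := hI.mem_toFinset.2 ha
  exact hy a (Finset.mem_union_left _ ha') b
    (Finset.mem_union_right _ (Finset.mem_biUnion.2 ⟨a, ha', hb⟩))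

instance : ContinuousSMul (autGroup circLang M) (AdmissibleOrders circClass M) := by
  refine ⟨Continuous.subtype_mk (continuous_pi fun a => continuous_pi fun b => ?_) _⟩
  rw [continuous_iff_continuousAt]
  rintro ⟨g, x⟩
  -- For fixed `a`, the point `g⁻¹ a` is locally constant in `g`, since the points of `M` are
  -- discrete.
  have h1 : ∀ a : M, ∀ᶠ p : autGroup circLang M × AdmissibleOrders circClass M in 𝓝 (g, x),
      p.1⁻¹.1 a = g⁻¹.1 a := fun a => by
    have h2 := (isOpen_autGroup_eval (g⁻¹.1 a) a).mem_nhds (autGroup_apply_inv g a)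
    have h3 : ∀ᶠ p : autGroup circLang M × AdmissibleOrders circClass M in 𝓝 (g, x),
      p.1.1 (g⁻¹.1 a) = a := (continuous_fst.tendsto (g, x)).eventually h2
    filter_upwards [h3] with p hp
    conv_lhs => rw [← hp]
    exact autGroup_inv_apply _ _
  have h4 : ContinuousAt (fun p : autGroup circLang M × AdmissibleOrders circClass M =>
      p.2.1 (g⁻¹.1 a) (g⁻¹.1 b)) (g, x) :=
    ((AdmissibleOrders.continuous_apply _ _).comp continuous_snd).continuousAt
  refine h4.congr ?_
  filter_upwards [h1 a, h1 b] with p hp hp'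
  rw [← hp, ← hp']

end

/-! ### Density of orbits and fixed points in flows -/

section

variable {M : Type} [circLang.Structure M]

/-- An automorphism of the circular order extending a finite partial one. -/
theorem HasDenseCuts.exists_autGroup [Countable M] (hR : HasDenseCuts (circRel M)) {ι : Type*}
    [Finite ι] (f g : ι → M) (hinj : ∀ i j, f i = f j ↔ g i = g j)
    (h : ∀ i j k, circRel M (f i) (f j) (f k) ↔ circRel M (g i) (g j) (g k)) :
    ∃ e : autGroup circLang M, ∀ i, e.1 (f i) = g i := by
  obtain ⟨e, he, he'⟩ := hR.exists_equiv f g hinj h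
  exact ⟨⟨e, mem_autGroup_iff.2 he⟩, he'⟩

theorem HasDenseCuts.infinite [Nonempty M] (hR : HasDenseCuts (circRel M)) : Infinite M := by
  obtain ⟨r, hr, -, -⟩ := hR ∅ (Classical.arbitrary M) Set.finite_empty
  have := hr.sto
  classical
  let _ := linearOrderOfSTO r
  have : NoMaxOrder M := ⟨hr.right⟩
  infer_instance

/-- A neighbourhood of `y` constrains only a finite set `F`. Since `(F, y)` is isomorphic to `(T,
x)` for any `T` of the same size, homogeneity of the circular order supplies an automorphism
carrying `T` to `F` in that way. -/
theorem isMinimal_admissibleOrders [Countable M] [Nonempty M] (hR : HasDenseCuts (circRel M)) :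
    MulAction.IsMinimal (autGroup circLang M) (AdmissibleOrders circClass M) := by
  classical
  have := hR.infinite
  refine ⟨fun x y => mem_closure_iff_nhds.2 fun U hU => ?_⟩
  obtain ⟨F, hF⟩ := exists_finite_of_mem_nhds hU
  have := x.sto
  have := y.sto
  obtain ⟨T, hT⟩ := Infinite.exists_subset_card_eq M F.card
  have hF' : IsStrictTotalOrder F fun a b => y.1 a b = true :=
    (⟨⟨Subtype.val, Subtype.coe_injective⟩, Iff.rfl⟩ :
      (fun a b : F => y.1 a b = true) ↪r fun a b => y.1 a b = true).isStrictTotalOrder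
  have hT' : IsStrictTotalOrder T fun a b => x.1 a b = true :=
    (⟨⟨Subtype.val, Subtype.coe_injective⟩, Iff.rfl⟩ :
      (fun a b : T => x.1 a b = true) ↪r fun a b => x.1 a b = true).isStrictTotalOrder
  obtain ⟨f, hf⟩ := exists_embedding_of_strictTotalOrder (fun a b : F => y.1 a b = true)
    (fun a b : T => x.1 a b = true) (by simp [hT])
  obtain ⟨e, he⟩ := hR.exists_autGroup (fun i => (f i : M)) (fun i : F => (i : M))
    (fun i j => by rw [Subtype.coe_injective.eq_iff, f.injective.eq_iff,
      Subtype.coe_injective.eq_iff]) (fun i j k => by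
      rw [x.circRel_iff, y.circRel_iff]
      exact (cyc_congr (r := fun a b : F => y.1 a b = true) (s := fun a b => x.1 a b = true)
        (fun i => (f i : M)) hf i j k).symm)
  refine ⟨e • x, hF _ fun a ha b hb => ?_, ⟨e, rfl⟩⟩
  have h1 : ∀ a (ha : a ∈ F), e⁻¹.1 a = f ⟨a, ha⟩ := fun a ha => by
    have := he ⟨a, ha⟩
    dsimp only at this
    conv_lhs => rw [← this]
    exact autGroup_inv_apply _ _
  rw [AdmissibleOrders.smul_apply, h1 a ha, h1 b hb]
  exact Bool.eq_iff_iff.2 (hf ⟨a, ha⟩ ⟨b, hb⟩).symm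

/-! ### Flows -/

section flows

variable {Y : Type*} [UniformSpace Y] [CompactSpace Y] [MulAction (autGroup circLang M) Y]
  [ContinuousSMul (autGroup circLang M) Y]

/-- Small automorphisms move all the points of a compact flow uniformly little. -/
theorem exists_finite_stabilizer_small {W : Set (Y × Y)} (hW : W ∈ 𝓤 Y) :
    ∃ F : Finset M, ∀ g : autGroup circLang M, (∀ a ∈ F, g.1 a = a) → ∀ y : Y, (y, g • y) ∈ W := by
  have h1 : ∀ᶠ g : autGroup circLang M in 𝓝 1, ∀ y ∈ (Set.univ : Set Y), (y, g • y) ∈ W := by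
    refine isCompact_univ.eventually_forall_of_forall_eventually fun y _ => ?_
    have h2 : Continuous fun p : autGroup circLang M × Y => (p.2, p.1 • p.2) :=
      continuous_snd.prodMk continuous_smul
    have h3 := h2.tendsto (1, y)
    simp only [one_smul] at h3
    exact h3.eventually (nhds_le_uniformity y hW)
  obtain ⟨F, hF⟩ := exists_finite_of_mem_nhds_one h1
  exact ⟨F, fun g hg y => hF g hg y trivial⟩

/-- `g` is an automorphism of the linear order `r`. -/
def PreservesOrder (r : M → M → Prop) (g : autGroup circLang M) : Prop :=
  ∀ a b, r a b ↔ r (g.1 a) (g.1 b)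

theorem PreservesOrder.inv {r : M → M → Prop} {g : autGroup circLang M} (h : PreservesOrder r g) :
    PreservesOrder r g⁻¹ := fun a b => by
  rw [h (g⁻¹.1 a), autGroup_apply_inv, autGroup_apply_inv]

theorem PreservesOrder.mul {r : M → M → Prop} {g k : autGroup circLang M} (h : PreservesOrder r g)
    (h' : PreservesOrder r k) : PreservesOrder r (g * k) := fun a b =>
  (h' a b).trans (h _ _)

/-- Automorphisms of a linear order which map a finite set onto the same set agree on it. -/
theorem PreservesOrder.eq_of_image_eq [DecidableEq M] {r : M → M → Prop} (hr : IsStrictTotalOrder M r)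
    {g k : autGroup circLang M} (h : PreservesOrder r g) (h' : PreservesOrder r k) {F : Finset M}
    (hF : F.image g.1 = F.image k.1) : ∀ a ∈ F, g.1 a = k.1 a := by
  classical
  let _ := linearOrderOfSTO r
  have h1 : StrictMono fun a : F => g.1 a := fun a b hab => (h a b).1 hab
  have h2 : StrictMono fun a : F => k.1 a := fun a b hab => (h' a b).1 hab
  have h3 := (h1.range_inj h2).1 (by
    ext x
    have := Finset.ext_iff.1 hF x
    simpa using this)
  exact fun a ha => congrFun h3 ⟨a, ha⟩

/-- Automorphisms of a dense linear order act transitively on the finite sets of a given size. -/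
theorem IsDenseUnbounded.exists_image_eq [Countable M] [Nonempty M] [DecidableEq M]
    {r : M → M → Prop} (hr : IsDenseUnbounded r)
    (hc : ∀ a b c, circRel M a b c ↔ cyc r a b c) {F U : Finset M} (h : U.card = F.card) :
    ∃ g : autGroup circLang M, PreservesOrder r g ∧ F.image g.1 = U := by
  classical
  have := hr.sto
  let _ := linearOrderOfSTO r
  obtain ⟨e, he, he'⟩ := hr.exists_equiv hr (F.orderEmbOfFin rfl) (U.orderEmbOfFin h)
    fun i j => (F.orderEmbOfFin rfl).lt_iff_lt.trans (U.orderEmbOfFin h).lt_iff_lt.symm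
  refine ⟨⟨e, mem_autGroup_iff.2 fun a b c => by rw [hc, hc]; exact cyc_congr e he a b c⟩, he, ?_⟩
  apply Finset.coe_injective
  rw [Finset.coe_image, ← Finset.range_orderEmbOfFin F rfl, ← Finset.range_orderEmbOfFin U h,
    ← Set.range_comp]
  exact congrArg Set.range (funext he')

/-- Almost fixed points for the automorphisms of a dense linear order, by Ramsey's theorem. -/
theorem exists_almost_fixed [Countable M] [Nonempty M] [Nonempty Y] {r : M → M → Prop}
    (hr : IsDenseUnbounded r) (hc : ∀ a b c, circRel M a b c ↔ cyc r a b c)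
    (hinf : Infinite M) {W : Set (Y × Y)} (hW : W ∈ 𝓤 Y) (I : Finset (autGroup circLang M))
    (hI : ∀ h ∈ I, PreservesOrder r h) : ∃ y : Y, ∀ h ∈ I, (y, h • y) ∈ W := by
  classical
  -- `W₁` controls both the distance to the finite net and the displacement by the stabiliser of
  -- `F`; composing these gives `W₂`. Comparing two points with a common net point gives `W`.
  obtain ⟨W₂, hW₂, hs₂, hc₂⟩ := comp_symm_mem_uniformity_sets hW
  obtain ⟨W₁, hW₁, hs₁, hc₁⟩ := comp_symm_mem_uniformity_sets hW₂
  obtain ⟨F, hF⟩ := exists_finite_stabilizer_small (M := M) hW₁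
  obtain ⟨t, ht, hcov⟩ := (isCompact_univ (X := Y)).totallyBounded W₁ hW₁
  have hcol : ∀ y : Y, ∃ c : t, (y, (c : Y)) ∈ W₁ := fun y => by
    obtain ⟨c, hct, hc'⟩ := Set.mem_iUnion₂.1 (hcov (Set.mem_univ y))
    exact ⟨⟨c, hct⟩, hc'⟩
  choose col hcol using hcol
  have := ht.to_subtype
  let ε := Finite.equivFin t
  have hG : ∀ U : Finset M, ∃ g : autGroup circLang M, U.card = F.card →
      PreservesOrder r g ∧ F.image g.1 = U := fun U => by
    by_cases hU : U.card = F.card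
    · obtain ⟨g, hg⟩ := hr.exists_image_eq hc hU
      exact ⟨g, fun _ => hg⟩
    · exact ⟨1, fun h => (hU h).elim⟩
  choose G hG using hG
  obtain ⟨y₁⟩ := ‹Nonempty Y›
  -- `B` contains the images of `F` under `1` and all `h⁻¹`, the only maps to which `key` will be
  -- applied.
  let B := F ∪ I.biUnion fun h => F.image h⁻¹.1
  obtain ⟨N, hN⟩ := exists_ramsey F.card (Nat.card t) B.card
  obtain ⟨S, hS⟩ := Infinite.exists_subset_card_eq M N
  -- A set `U` of the size of `F` is coloured by the net point near `(G U)⁻¹ • y₁`, where `G U`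
  -- carries `F` to `U` in increasing order.
  obtain ⟨i, T, -, hT, hi⟩ := hN M S hS.ge fun U => ε (col ((G U)⁻¹ • y₁))
  obtain ⟨g, hg, hgB⟩ := hr.exists_image_eq hc hT
  have key : ∀ k : autGroup circLang M, PreservesOrder r k → F.image k.1 ⊆ B →
      ((ε.symm i : Y), k⁻¹ • g⁻¹ • y₁) ∈ W₂ := by
    intro k hk hkB
    let U := F.image (g * k).1
    have hU : U.card = F.card := Finset.card_image_of_injective _ (g * k).1.injective
    have hUT : U ⊆ T := by
      intro x hx
      obtain ⟨a, ha, rfl⟩ := Finset.mem_image.1 hx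
      rw [← hgB]
      exact Finset.mem_image_of_mem _ (hkB (Finset.mem_image_of_mem _ ha))
    have h1 := hcol ((G U)⁻¹ • y₁)
    rw [(ε.eq_symm_apply.2 (hi U hUT hU) : col ((G U)⁻¹ • y₁) = _)] at h1
    -- `G U` and `g * k` send `F` to the same set in increasing order, hence agree on `F`. Thus `k⁻¹
    -- * g⁻¹ * G U` fixes `F` pointwise and moves every point little.
    have h2 := PreservesOrder.eq_of_image_eq hr.sto (hG U hU).1 (hg.mul hk) (hG U hU).2
    have h3 := hF (k⁻¹ * g⁻¹ * G U) (fun a ha => by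
      change k⁻¹.1 (g⁻¹.1 ((G U).1 a)) = a
      rw [h2 a ha]
      change k⁻¹.1 (g⁻¹.1 (g.1 (k.1 a))) = a
      rw [autGroup_inv_apply, autGroup_inv_apply]) ((G U)⁻¹ • y₁)
    rw [mul_smul, smul_inv_smul, mul_smul] at h3
    exact hc₁ ⟨_, hs₁.symm _ _ h1, h3⟩
  refine ⟨g⁻¹ • y₁, fun h hh => hc₂ ⟨ε.symm i, hs₂.symm _ _ ?_, ?_⟩⟩
  · have h1 := key 1 (fun _ _ => Iff.rfl) (by
      intro x hx
      obtain ⟨a, ha, rfl⟩ := Finset.mem_image.1 hx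
      exact Finset.mem_union_left _ ha)
    rwa [inv_one, one_smul] at h1
  · have h1 := key h⁻¹ (hI h hh).inv (fun x hx =>
      Finset.mem_union_right _ (Finset.mem_biUnion.2 ⟨h, hh, hx⟩))
    rwa [inv_inv] at h1

/-- The automorphism group of a dense linear order is extremely amenable. -/
theorem exists_fixed [T0Space Y] [Countable M] [Nonempty M] [Nonempty Y] {r : M → M → Prop}
    (hr : IsDenseUnbounded r) (hc : ∀ a b c, circRel M a b c ↔ cyc r a b c)
    (hinf : Infinite M) : ∃ y : Y, ∀ h : autGroup circLang M, PreservesOrder r h → h • y = y := by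
  classical
  let Z : {h : autGroup circLang M // PreservesOrder r h} × {W : Set (Y × Y) // W ∈ 𝓤 Y ∧ IsClosed W} →
    Set Y := fun p => {y | (y, p.1.1 • y) ∈ p.2.1}
  -- Fixed points form an intersection of closed sets indexed by automorphisms and closed
  -- entourages. Finitely many of these conditions hold together at an almost fixed point for the
  -- intersection of the entourages.
  have hZ : (⋂ p, Z p).Nonempty := by
    refine CompactSpace.iInter_nonempty (fun p => ?_) fun s => ?_
    · exact p.2.2.2.preimage (continuous_id.prodMk (continuous_const_smul p.1.1))
    · obtain ⟨y, hy⟩ := exists_almost_fixed (Y := Y) hr hc hinf (W := ⋂ p ∈ s, p.2.1)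
        ((biInter_finset_mem s).2 fun p _ => p.2.2.1) (s.image fun p => p.1.1) (by
          intro h hh
          obtain ⟨p, -, rfl⟩ := Finset.mem_image.1 hh
          exact p.1.2)
      refine ⟨y, Set.mem_iInter₂.2 fun p hp => ?_⟩
      exact Set.mem_iInter₂.1 (hy _ (Finset.mem_image_of_mem _ hp)) p hp
  obtain ⟨y, hy⟩ := hZ
  refine ⟨y, fun h hh => ?_⟩
  refine (eq_of_uniformity_basis uniformity_hasBasis_closed fun {W} hW => ?_).symm
  exact Set.mem_iInter.1 hy (⟨h, hh⟩, ⟨W, hW⟩)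

end flows

/-! ### Universality of the space of admissible orders -/

/-- The space of admissible orders maps equivariantly to every minimal flow. -/
theorem exists_equivariant_map [Countable M] [Nonempty M] (hR : HasDenseCuts (circRel M))
    {Y : Type*} [TopologicalSpace Y] [CompactSpace Y] [T2Space Y] [Nonempty Y]
    [MulAction (autGroup circLang M) Y] [ContinuousSMul (autGroup circLang M) Y] :
    ∃ f : AdmissibleOrders circClass M → Y, Continuous f ∧
      ∀ (g : autGroup circLang M) x, f (g • x) = g • f x := by
  classical
  have hinf := hR.infinite
  let _ := uniformSpaceOfCompactR1 (γ := Y)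
  obtain ⟨r, hr, hc, -⟩ := hR ∅ (Classical.arbitrary M) Set.finite_empty
  obtain ⟨y₀, hy₀⟩ := exists_fixed (Y := Y) hr hc hinf
  let x₀ := AdmissibleOrders.of r hr.sto hc
  have := isMinimal_admissibleOrders hR
  let O := MulAction.orbit (autGroup circLang M) x₀
  have hO : ∀ o : O, ∃ g : autGroup circLang M, g • x₀ = o := fun o => o.2
  choose γ hγ using hO
  have hx₀ : ∀ a b, x₀.1 a b = true ↔ r a b := fun a b => AdmissibleOrders.of_iff
  let φ : O → Y := fun o => γ o • y₀
  -- Independence of the chosen `γ o`: two elements carrying `x₀` to `o` differ by an automorphism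
  -- of `r`, which fixes `y₀`.
  have hφ : ∀ (g : autGroup circLang M) (o : O), g • x₀ = o → φ o = g • y₀ := by
    intro g o ho
    have h1 : PreservesOrder r (g⁻¹ * γ o) := fun a b => by
      have h2 : (γ o)⁻¹ • g • x₀ = x₀ := by rw [ho, ← hγ o, inv_smul_smul]
      rw [← hx₀, ← hx₀]
      conv_lhs => rw [← h2]
      exact Iff.rfl
    have h3 := hy₀ _ h1
    rw [mul_smul, inv_smul_eq_iff] at h3
    exact h3
  have hde : IsDenseInducing (Subtype.val : O → AdmissibleOrders circClass M) :=
    ⟨IsInducing.subtypeVal, by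
      rw [DenseRange, Subtype.range_coe]
      exact MulAction.dense_orbit (autGroup circLang M) x₀⟩
  have hlim : ∀ x, ∃ c, Tendsto φ (comap Subtype.val (𝓝 x)) (𝓝 c) := by
    intro x
    have hne := hde.comap_nhds_neBot x
    refine cauchy_map_iff_exists_tendsto.1 (cauchy_map_iff.2 ⟨hne, ?_⟩)
    intro W hW
    obtain ⟨F, hF⟩ := exists_finite_stabilizer_small (M := M) hW
    have hN := preimage_mem_comap (m := (Subtype.val : O → AdmissibleOrders circClass M))
      (finite_agreement_mem_nhds x F)
    refine mem_map.2 (mem_of_superset (prod_mem_prod hN hN) ?_)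
    rintro ⟨o, o'⟩ ⟨ho, ho'⟩
    -- The orders `o` and `o'` agree on `F`, so some automorphism `h` of `r` matches the two
    -- pullbacks of `F`. Then `γ o' * h * (γ o)⁻¹` fixes `F` pointwise and carries `φ o` to `φ o'`,
    -- so these values are close.
    obtain ⟨e, he, he'⟩ := hr.exists_equiv hr (fun a : F => (γ o)⁻¹.1 a) (fun a : F => (γ o')⁻¹.1 a)
      fun a b => by
        have h1 := ho a a.2 b b.2
        have h2 := ho' a a.2 b b.2
        rw [← h2, ← hγ o, ← hγ o'] at h1
        rw [← hx₀, ← hx₀]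
        exact Bool.eq_iff_iff.1 h1
    let h : autGroup circLang M :=
      ⟨e, mem_autGroup_iff.2 fun a b c => by rw [hc, hc]; exact cyc_congr e he a b c⟩
    have h1 := hF (γ o' * h * (γ o)⁻¹) (fun a ha => by
      have h2 : h.1 ((γ o)⁻¹.1 a) = (γ o')⁻¹.1 a := he' ⟨a, ha⟩
      change (γ o').1 (h.1 ((γ o)⁻¹.1 a)) = a
      rw [h2, autGroup_apply_inv]) (γ o • y₀)
    rwa [mul_smul, mul_smul, inv_smul_smul, hy₀ h he] at h1
  have hcont : Continuous φ := by
    rw [continuous_iff_continuousAt]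
    intro o
    obtain ⟨c, hc'⟩ := hlim o
    rw [← hde.isInducing.nhds_eq_comap] at hc'
    exact continuousAt_of_tendsto_nhds hc'
  refine ⟨hde.extend φ, hde.continuous_extend hlim, fun g x => ?_⟩
  have hext := hde.continuous_extend hlim
  have h1 : Continuous fun x => hde.extend φ (g • x) := hext.comp (continuous_const_smul g)
  have h2 : Continuous fun x => g • hde.extend φ x := hext.const_smul g
  refine congrFun (Continuous.ext_on hde.dense h1 h2 ?_) x
  rintro _ ⟨o, rfl⟩
  have h3 : g • (o : AdmissibleOrders circClass M) = (g • o : O) := rfl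
  dsimp only
  rw [h3, hde.extend_eq hcont, hde.extend_eq hcont, hφ (g * γ o) (g • o) (by
    rw [mul_smul, hγ]; rfl), mul_smul]

theorem isUniversalMinimalFlow_admissibleOrders [Countable M] [Nonempty M]
    (hR : HasDenseCuts (circRel M)) :
    IsUniversalMinimalFlow.{u} (autGroup circLang M) (AdmissibleOrders circClass M) := by
  refine ⟨⟨?_, inferInstance, inferInstance, inferInstance, isMinimal_admissibleOrders hR⟩, ?_⟩
  · obtain ⟨r, hr, hc, -⟩ := hR ∅ (Classical.arbitrary M) Set.finite_empty
    exact ⟨AdmissibleOrders.of r hr.sto hc⟩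
  · intro Y _ _ hY
    have := hY.nonempty
    have := hY.compact
    have := hY.hausdorff
    have := hY.continuous
    exact exists_equivariant_map hR

end

/-! ### Coordinates on the split circle -/

section linear

variable {E : Type*} [LinearOrder E]

theorem cyc_cut_of_between {s t a b : E} (h : cyc (· < ·) s a t) (h' : cyc (· < ·) t b s) :
    cyc (· < ·) s a b ∧ cyc (· < ·) t b a := by
  unfold cyc at *; grind

theorem cyc_cuts_of_between {s t u a b c : E} (h : cyc (· < ·) s t u) (ha : cyc (· < ·) s a t) (hb : cyc (· < ·) t b u)
    (hc : cyc (· < ·) u c s) : cyc (· < ·) s a b ∧ cyc (· < ·) s b c := by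
  unfold cyc at *; grind

theorem cyc_of_cuts {s t u a b c : E} (h1 : cyc (· < ·) s a b) (h2 : cyc (· < ·) s b c)
    (h3 : cyc (· < ·) t b c) (h4 : cyc (· < ·) t c a) (h5 : cyc (· < ·) u c a)
    (h6 : cyc (· < ·) u a b) : cyc (· < ·) s t u := by
  unfold cyc at *; grind

theorem cyc_arc_subset_compl {s t u a b : E} (ha : cyc (· < ·) u a s) (hb : cyc (· < ·) t b u)
    (h : s = t ∨ cyc (· < ·) s t u) : cyc (· < ·) u a b ∧
      ∀ v, cyc (· < ·) v a b → ¬ (cyc (· < ·) s v t ∨ v = s ∨ v = t) := by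
  unfold cyc at *; grind

theorem isStrictTotalOrder_cyc_left {X : Type*} {f : X → E} (hf : Function.Injective f) {z : E}
    (hz : ∀ a, f a ≠ z) :
    IsStrictTotalOrder X (fun a b => cyc (· < ·) z (f a) (f b)) ∧
      ∀ a b c, cyc (· < ·) (f a) (f b) (f c) ↔
        cyc (fun x y => cyc (· < ·) z (f x) (f y)) a b c := by
  have hE : IsCircularOrder (cyc ((· < ·) : E → E → Prop)) := isCircularOrder_cyc
  have h1 : ∀ a b, cyc (· < ·) z (f a) (f b) ↔ cutAt (cyc (· < ·)) z (f a) (f b) := fun a b => by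
    simp [cutAt, hz]
  have := isStrictTotalOrder_cutAt hE z
  refine ⟨(⟨⟨f, hf⟩, (h1 _ _).symm⟩ : (fun a b => cyc (· < ·) z (f a) (f b)) ↪r
    cutAt (cyc (· < ·)) z).isStrictTotalOrder, fun a b c => ?_⟩
  rw [eq_cyc_cutAt hE z]
  exact (cyc_congr f h1 a b c).symm

end linear

/-- A linear order is determined by the circular order it induces and the predecessors of one
point. -/
theorem eq_of_cyc_eq {X : Type*} {r r' : X → X → Prop} [IsStrictTotalOrder X r]
    [IsStrictTotalOrder X r'] (h : ∀ a b c, cyc r a b c ↔ cyc r' a b c) {z : X}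
    (hz : ∀ a, r a z ↔ r' a z) (a b : X) : r a b ↔ r' a b := by
  have key : ∀ {r r' : X → X → Prop}, IsStrictTotalOrder X r → IsStrictTotalOrder X r' →
      (∀ a b c, cyc r a b c ↔ cyc r' a b c) → (∀ a, r a z ↔ r' a z) → r a b → r' a b := by
    intro r r' hr hr' h hz hab
    have irr : ∀ a, ¬ r a a := irrefl_of r
    have as : ∀ {a b}, r a b → ¬ r b a := fun h => asymm_of r h
    have as' : ∀ {a b}, r' a b → ¬ r' b a := fun h => asymm_of r' h
    have h1 := h z a b
    have h2 := hz a
    have h3 := hz b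
    unfold cyc at h1
    rcases trichotomous_of r' a b with g | rfl | g
    · exact g
    · exact (irr _ hab).elim
    · exfalso
      have := as' g
      rcases trichotomous_of r a z with k | rfl | k
      · have k' := h2.1 k
        have := as' k'
        have := as k
        rcases trichotomous_of r b z with l | rfl | l
        · tauto
        · tauto
        · exact this (by
            have h4 : ¬ r' b z := fun h4 => as (h3.2 h4) l
            exact (h4 (trans_of r' g k')).elim)
      · exact as hab (h3.2 g)
      · have := as k
        have := as (trans_of r k hab)
        tauto
  exact ⟨key ‹_› ‹_› h hz, key ‹_› ‹_› (fun a b c => (h a b c).symm) fun a => (hz a).symm⟩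

namespace Split

/-- `-1` for the points `a⁻`, `1` for the points `a⁺`, and `0` for the points which are not split. -/
def sign {X : Type*} {A : Set X} : Split A → ℤ
  | single _ _ => 0
  | minus _ => -1
  | plus _ => 1

/-- The split circle as a subset of `[0, 1) × {-1, 0, 1}` with the lexicographic order. -/
noncomputable def coord (s : Split rationalPoints) : ℝ ×ₗ ℤ := toLex (rep 0 s.proj, s.sign)

/-- The position of a rational point, between `q⁻` and `q⁺`. -/
noncomputable def mid (q : rationalPoints) : ℝ ×ₗ ℤ := toLex (rep 0 q, 0)

theorem sign_eq_zero_iff {X : Type*} {A : Set X} (s : Split A) : s.sign = 0 ↔ s.proj ∉ A := by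
  cases s with
  | single x hx => simpa [sign, proj] using hx
  | minus a => simp [sign, proj]
  | plus a => simp [sign, proj]

theorem sign_cases {X : Type*} {A : Set X} (s : Split A) :
    s.sign = -1 ∨ s.sign = 0 ∨ s.sign = 1 := by
  cases s <;> simp [sign]

theorem sign_zero_congr {s t : Split rationalPoints} (h : rep 0 s.proj = rep 0 t.proj) :
    s.sign = 0 ↔ t.sign = 0 := by
  rw [sign_eq_zero_iff, sign_eq_zero_iff, rep_injective 0 h]

theorem isSplitPair_iff (s t : Split rationalPoints) :
    IsSplitPair s t ↔ s.sign = -1 ∧ t.sign = 1 ∧ rep 0 s.proj = rep 0 t.proj := by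
  rw [(rep_injective 0).eq_iff]
  constructor
  · rintro ⟨a, rfl, rfl⟩
    exact ⟨rfl, rfl, rfl⟩
  · rintro ⟨h1, h2, h3⟩
    cases s <;> cases t <;> simp_all [sign, proj, IsSplitPair, Subtype.ext_iff]

theorem coord_injective : Function.Injective coord := by
  intro s t h
  have h1 : rep 0 s.proj = rep 0 t.proj := congrArg (fun x => (ofLex x).1) h
  have h2 : s.sign = t.sign := congrArg (fun x => (ofLex x).2) h
  have h3 := rep_injective 0 h1
  cases s <;> cases t <;> simp_all [sign, proj, Subtype.ext_iff]

theorem mid_injective : Function.Injective mid := fun _ _ h =>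
  Subtype.ext (rep_injective 0 (congrArg (fun x => (ofLex x).1) h))

theorem mid_ne_coord (q : rationalPoints) (s : Split rationalPoints) : mid q ≠ coord s := by
  intro h
  have h1 : rep 0 q = rep 0 s.proj := congrArg (fun x => (ofLex x).1) h
  have h2 : 0 = s.sign := congrArg (fun x => (ofLex x).2) h
  have h3 := (sign_eq_zero_iff s).1 h2.symm
  rw [← rep_injective 0 h1] at h3
  exact h3 q.2

/-- The last three hypotheses say that points with the same projection are both split or both
unsplit. Equal first coordinates are then separated only as a pair `q⁻, q⁺`. -/
theorem cyc_lex_iff {a b c : ℝ} {i j k : ℤ} (hi : i = -1 ∨ i = 0 ∨ i = 1)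
    (hj : j = -1 ∨ j = 0 ∨ j = 1) (hk : k = -1 ∨ k = 0 ∨ k = 1) (hab : a = b → (i = 0 ↔ j = 0))
    (hbc : b = c → (j = 0 ↔ k = 0)) (hca : c = a → (k = 0 ↔ i = 0)) :
    (cyc (· < ·) a b c ∨ ((i = -1 ∧ j = 1 ∧ a = b) ∧ c ≠ a) ∨ ((j = -1 ∧ k = 1 ∧ b = c) ∧ a ≠ b) ∨
      ((k = -1 ∧ i = 1 ∧ c = a) ∧ b ≠ c)) ↔
      cyc (· < ·) (toLex (a, i)) (toLex (b, j)) (toLex (c, k)) := by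
  unfold cyc
  simp only [Prod.Lex.toLex_lt_toLex]
  rcases lt_trichotomy a b with h1 | h1 | h1 <;> rcases lt_trichotomy b c with h2 | h2 | h2 <;>
    rcases lt_trichotomy c a with h3 | h3 | h3 <;> grind

theorem circ_iff (s t u : Split rationalPoints) :
    circ s t u ↔ cyc (· < ·) (coord s) (coord t) (coord u) := by
  unfold circ
  rw [sbtw_iff_rep 0, isSplitPair_iff, isSplitPair_iff, isSplitPair_iff,
    ← (rep_injective 0).ne_iff, ← (rep_injective 0).ne_iff, ← (rep_injective 0).ne_iff]
  exact cyc_lex_iff s.sign_cases t.sign_cases u.sign_cases sign_zero_congr sign_zero_congr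
    sign_zero_congr

/-- Rationals are dense between distinct projections; between `q⁻` and `q⁺` the point `q` itself
serves. -/
theorem exists_mid_between {s t : Split rationalPoints} (h : s ≠ t) :
    ∃ q, cyc (· < ·) (coord s) (mid q) (coord t) := by
  have h0 : ∀ s : Split rationalPoints, rep 0 s.proj < 1 := fun s => by
    have := (rep_mem 0 s.proj).2
    rwa [zero_add] at this
  have key : ∀ a b : ℝ, 0 ≤ a → a < b → b ≤ 1 →
      ∃ q : rationalPoints, a < rep 0 q ∧ rep 0 q < b := fun a b h1 h2 h3 => by
    obtain ⟨q, hq, hq'⟩ := exists_rat_btwn h2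
    refine ⟨⟨_, rational_mem q⟩, ?_⟩
    rw [rep_coe ⟨h1.trans hq.le, by linarith⟩]
    exact ⟨hq, hq'⟩
  rcases lt_or_gt_of_ne (coord_injective.ne h) with h1 | h1
  · have h2 := h1
    unfold coord at h2
    rw [Prod.Lex.toLex_lt_toLex] at h2
    rcases h2 with h2 | ⟨h2, h3⟩
    · obtain ⟨q, hq, hq'⟩ := key _ _ (rep_mem 0 s.proj).1 h2 (h0 t).le
      exact ⟨q, Or.inl ⟨Prod.Lex.toLex_lt_toLex.2 (Or.inl hq),
        Prod.Lex.toLex_lt_toLex.2 (Or.inl hq')⟩⟩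
    · dsimp only at h2 h3
      have h4 := sign_zero_congr h2
      have h5 : s.sign < 0 ∧ 0 < t.sign := by
        have := s.sign_cases
        have := t.sign_cases
        omega
      have h6 : s.proj ∈ rationalPoints := by
        by_contra h7
        have := (sign_eq_zero_iff s).2 h7
        omega
      exact ⟨⟨_, h6⟩, Or.inl ⟨Prod.Lex.toLex_lt_toLex.2 (Or.inr ⟨rfl, h5.1⟩),
        Prod.Lex.toLex_lt_toLex.2 (Or.inr ⟨h2, h5.2⟩)⟩⟩
  -- The arc from `s` to `t` passes through the origin, so it contains a rational with
  -- representative between that of `s` and `1`.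
  · obtain ⟨q, hq, -⟩ := key _ _ (rep_mem 0 s.proj).1 (h0 s) le_rfl
    exact ⟨q, Or.inr (Or.inr ⟨h1, Prod.Lex.toLex_lt_toLex.2 (Or.inl hq)⟩)⟩

theorem cyc_mid_iff (a b c : rationalPoints) :
    circRel rationalPoints a b c ↔ cyc (· < ·) (mid a) (mid b) (mid c) := by
  refine (sbtw_iff_rep 0 a b c).trans (cyc_congr (r := fun x y : ℝ => x < y)
    (s := fun x y : ℝ ×ₗ ℤ => x < y) (fun x => toLex (x, (0 : ℤ))) (fun _ _ => ?_) _ _ _)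
  simp [Prod.Lex.toLex_lt_toLex]

/-! ### Split points as admissible orders -/

/-- The order obtained by cutting the circle at a point of the split circle. -/
noncomputable def cut (s : Split rationalPoints) : AdmissibleOrders circClass rationalPoints :=
  AdmissibleOrders.of (fun a b => cyc (· < ·) (coord s) (mid a) (mid b))
    (isStrictTotalOrder_cyc_left mid_injective fun a => mid_ne_coord a s).1 fun a b c =>
      (cyc_mid_iff a b c).trans
        ((isStrictTotalOrder_cyc_left mid_injective fun a => mid_ne_coord a s).2 a b c)

theorem cut_iff {s : Split rationalPoints} {a b : rationalPoints} :
    (cut s).1 a b = true ↔ cyc (· < ·) (coord s) (mid a) (mid b) := AdmissibleOrders.of_iff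

theorem eq_of_pred_iff {x y : AdmissibleOrders circClass rationalPoints} (z : rationalPoints)
    (h : ∀ a, x.1 a z = true ↔ y.1 a z = true) : x = y := by
  have := x.sto
  have := y.sto
  exact AdmissibleOrders.ext_iff_true.2 fun a b =>
    eq_of_cyc_eq (r := fun a b => x.1 a b = true) (r' := fun a b => y.1 a b = true)
      (fun a b c => (x.circRel_iff a b c).symm.trans (y.circRel_iff a b c)) h a b

theorem cut_minus_pred (q a : rationalPoints) : ¬ (cut (minus q)).1 a q = true := by
  rw [cut_iff]
  have h1 : coord (minus q) < mid q := Prod.Lex.toLex_lt_toLex.2 (Or.inr ⟨rfl, by simp [sign]⟩)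
  intro h
  have h2 : coord (minus q) < mid a → mid a < mid q → False := fun h2 h3 => by
    unfold coord mid at *
    rw [Prod.Lex.toLex_lt_toLex] at h2 h3
    simp only [sign, proj] at h2 h3
    grind
  unfold cyc at h
  grind

theorem cut_plus_pred (q a : rationalPoints) : (cut (plus q)).1 a q = true ↔ a ≠ q := by
  constructor
  · rintro h rfl
    have := (cut (plus a)).sto
    exact irrefl_of (fun b c => (cut (plus a)).1 b c = true) a h
  intro h
  rw [cut_iff]
  have h1 : mid q < coord (plus q) := Prod.Lex.toLex_lt_toLex.2 (Or.inr ⟨rfl, by simp [sign]⟩)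
  have h2 : mid q < mid a → mid a < coord (plus q) → False := fun h2 h3 => by
    unfold coord mid at *
    rw [Prod.Lex.toLex_lt_toLex] at h2 h3
    simp only [sign, proj] at h2 h3
    grind
  have h3 := mid_injective.ne h
  have h4 := mid_ne_coord a (plus q)
  unfold cyc
  grind

/-- Distinct points bound two arcs. Rationals chosen one in each arc are ordered oppositely by the
two cuts. -/
theorem cut_injective : Function.Injective cut := by
  intro s t h
  by_contra hst
  obtain ⟨a, ha⟩ := exists_mid_between hst
  obtain ⟨b, hb⟩ := exists_mid_between (Ne.symm hst)
  obtain ⟨h1, h2⟩ := cyc_cut_of_between ha hb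
  rw [← cut_iff] at h1 h2
  rw [h] at h1
  have := (cut t).sto
  exact asymm_of (fun a b => (cut t).1 a b = true) h1 h2

/-- The predecessors of one point determine an admissible order (`eq_of_pred_iff`). A least or
greatest element `q` gives `q⁻` or `q⁺`; otherwise the order is a Dedekind gap. -/
theorem cut_surjective : Function.Surjective cut := by
  intro x
  have hx := x.sto
  have irr : ∀ a, ¬ x.1 a a = true := irrefl_of (fun a b => x.1 a b = true)
  have as : ∀ {a b}, x.1 a b = true → ¬ x.1 b a = true :=
    fun h => asymm_of (fun a b => x.1 a b = true) h
  have tr : ∀ {a b c}, x.1 a b = true → x.1 b c = true → x.1 a c = true :=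
    fun h h' => trans_of (fun a b => x.1 a b = true) h h'
  have tri : ∀ a b, x.1 a b = true ∨ a = b ∨ x.1 b a = true :=
    fun a b => trichotomous_of (fun a b => x.1 a b = true) a b
  by_cases hmin : ∃ q, ∀ a, ¬ x.1 a q = true
  · obtain ⟨q, hq⟩ := hmin
    exact ⟨minus q, eq_of_pred_iff q fun a => iff_of_false (cut_minus_pred q a) (hq a)⟩
  by_cases hmax : ∃ q, ∀ a, ¬ x.1 q a = true
  · obtain ⟨q, hq⟩ := hmax
    refine ⟨plus q, eq_of_pred_iff q fun a => (cut_plus_pred q a).trans ⟨fun h => ?_, fun h => ?_⟩⟩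
    · have := tri a q
      have := hq a
      tauto
    · rintro rfl
      exact irr _ h
  push Not at hmin hmax
  let o : rationalPoints := ⟨_, rational_mem 0⟩
  have ho : rep 0 o = 0 := by
    have : (o : UnitAddCircle) = ((0 : ℝ) : UnitAddCircle) := by simp [o]
    rw [this, rep_coe (by simp)]
  have hrep : ∀ a : rationalPoints, a ≠ o → 0 < rep 0 a := fun a ha =>
    lt_of_le_of_ne (rep_mem 0 a).1 fun h => ha (Subtype.ext (rep_injective 0 (by rw [← h, ho])))
  have hcyc : ∀ a b : rationalPoints, a ≠ o → rep 0 a < rep 0 b →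
      cyc (fun a b => x.1 a b = true) o a b := fun a b ha hab =>
    (x.circRel_iff o a b).1 ((sbtw_iff_rep 0 o a b).2 (Or.inl ⟨by rw [ho]; exact hrep a ha, hab⟩))
  have hne : ∀ a b : rationalPoints, a ≠ b → rep 0 a ≠ rep 0 b := fun a b h h' =>
    h (Subtype.ext (rep_injective 0 h'))
  -- Cut at `o`, the circle is `[0, 1)`, and the points not preceding `o` form an initial segment of
  -- it. Its supremum `y` is the place of the cut.
  have hdown : ∀ a b : rationalPoints, ¬ x.1 a o = true → rep 0 b < rep 0 a → ¬ x.1 b o = true := by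
    intro a b ha hab hb
    have hbo : b ≠ o := fun h => irr o (h ▸ hb)
    have := as hb
    rcases hcyc b a hbo hab with h | h | h <;> tauto
  let S : Set ℝ := {y | ∃ a : rationalPoints, ¬ x.1 a o = true ∧ rep 0 a = y}
  obtain ⟨p, hp⟩ := hmin o
  have hub : ∀ a : rationalPoints, x.1 a o = true → rep 0 a ∈ upperBounds S := by
    rintro a ha _ ⟨b, hb, rfl⟩
    by_contra hlt
    exact hdown b a hb (not_le.1 hlt) ha
  have hS : IsLUB S (sSup S) := isLUB_csSup ⟨_, o, irr o, rfl⟩ ⟨_, hub p hp⟩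
  set y := sSup S
  have hy0 : 0 ≤ y := hS.1 ⟨o, irr o, ho⟩
  have hy1 : y < 1 := by
    have := (rep_mem 0 p).2
    rw [zero_add] at this
    exact (hS.2 (hub p hp)).trans_lt this
  -- Without least or greatest element, `y` is attained on neither side. It therefore represents no
  -- rational point.
  have hupper : ∀ a : rationalPoints, x.1 a o = true → y < rep 0 a := by
    intro a ha
    refine lt_of_le_of_ne (hS.2 (hub a ha)) fun hya => ?_
    obtain ⟨b, hb⟩ := hmin a
    have hbo := tr hb ha
    have h1 : rep 0 a < rep 0 b := lt_of_le_of_ne (hya ▸ hS.2 (hub b hbo))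
      (hne a b fun h => irr a (by rw [← h] at hb; exact hb))
    have := as ha
    have := as hb
    have := as hbo
    rcases hcyc a b (fun h => irr o (h ▸ ha)) h1 with h | h | h <;> tauto
  have hlower : ∀ a : rationalPoints, ¬ x.1 a o = true → rep 0 a < y := by
    intro a ha
    refine lt_of_le_of_ne (hS.1 ⟨a, ha, rfl⟩) fun hya => ?_
    obtain ⟨b, hb⟩ := hmax a
    have hbo : ¬ x.1 b o = true := fun h => ha (tr hb h)
    have h1 : rep 0 b < rep 0 a := lt_of_le_of_ne (hya ▸ hS.1 ⟨b, hbo, rfl⟩)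
      (hne b a fun h => irr a (by rw [h] at hb; exact hb))
    have := as hb
    rcases hcyc b a (fun h => ha (h ▸ hb)) h1 with h | h | h <;> tauto
  have hy : rep 0 (y : UnitAddCircle) = y := rep_coe ⟨hy0, by rwa [zero_add]⟩
  have hyQ : (y : UnitAddCircle) ∉ rationalPoints := fun h => by
    by_cases h' : x.1 ⟨_, h⟩ o = true
    · have := hupper _ h'
      rw [hy] at this
      exact lt_irrefl _ this
    · have := hlower _ h'
      rw [hy] at this
      exact lt_irrefl _ this
  have hypos : 0 < y := by
    have := hlower o (irr o)
    rwa [ho] at this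
  refine ⟨single _ hyQ, eq_of_pred_iff o fun a => cut_iff.trans ?_⟩
  have h1 : mid o < coord (single _ hyQ) := Prod.Lex.toLex_lt_toLex.2 (Or.inl (by
    simpa [ho, proj, hy] using hypos))
  have h2 : ¬ mid a < mid o := by
    unfold mid
    rw [Prod.Lex.toLex_lt_toLex]
    have := (rep_mem 0 a).1
    simp [ho, this]
  have h3 : coord (single _ hyQ) < mid a ↔ y < rep 0 a := by
    unfold coord mid
    rw [Prod.Lex.toLex_lt_toLex]
    simp [proj, sign, hy]
  have h4 : cyc (· < ·) (coord (single _ hyQ)) (mid a) (mid o) ↔ y < rep 0 a := by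
    rw [← h3]
    unfold cyc
    tauto
  rw [h4]
  refine ⟨fun h => ?_, hupper a⟩
  by_contra h'
  exact lt_asymm h (hlower a h')

/-- The witnesses are rationals in the three arcs between `s`, `t` and `u`. Phrased through cuts
alone, the circular order is visibly preserved by the transported action. -/
theorem circ_iff_cut (s t u : Split rationalPoints) :
    circ s t u ↔ ∃ a b c, (cut s).1 a b = true ∧ (cut s).1 b c = true ∧ (cut t).1 b c = true ∧
      (cut t).1 c a = true ∧ (cut u).1 c a = true ∧ (cut u).1 a b = true := by
  rw [circ_iff]
  simp only [cut_iff]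
  constructor
  · intro h
    obtain ⟨h1, h2, h3⟩ := cyc_ne h
    obtain ⟨a, ha⟩ := exists_mid_between (ne_of_apply_ne _ h1)
    obtain ⟨b, hb⟩ := exists_mid_between (ne_of_apply_ne _ h2)
    obtain ⟨c, hc⟩ := exists_mid_between (ne_of_apply_ne _ h3)
    exact ⟨a, b, c, (cyc_cuts_of_between h ha hb hc).1, (cyc_cuts_of_between h ha hb hc).2,
      (cyc_cuts_of_between (cyc_rotate.1 h) hb hc ha).1, (cyc_cuts_of_between (cyc_rotate.1 h) hb hc ha).2,
      (cyc_cuts_of_between (cyc_rotate.1 (cyc_rotate.1 h)) hc ha hb).1, (cyc_cuts_of_between (cyc_rotate.1 (cyc_rotate.1 h)) hc ha hb).2⟩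
  · rintro ⟨a, b, c, h1, h2, h3, h4, h5, h6⟩
    exact cyc_of_cuts h1 h2 h3 h4 h5 h6

theorem coord_lt_mid_iff (s : Split rationalPoints) (a : rationalPoints) :
    coord s < mid a ↔ coord s ≤ coord (minus a) := by
  unfold coord mid
  rw [Prod.Lex.toLex_lt_toLex, Prod.Lex.toLex_le_toLex]
  have := s.sign_cases
  have h : rep 0 s.proj = rep 0 a → s.sign ≠ 0 := fun h h' =>
    (sign_eq_zero_iff s).1 h' (by rw [rep_injective 0 h]; exact a.2)
  change _ ∨ _ = rep 0 a ∧ _ < (0 : ℤ) ↔ _ < rep 0 a ∨ _ = rep 0 a ∧ _ ≤ (-1 : ℤ)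
  grind

theorem mid_lt_coord_iff (s : Split rationalPoints) (a : rationalPoints) :
    mid a < coord s ↔ coord (plus a) ≤ coord s := by
  unfold coord mid
  rw [Prod.Lex.toLex_lt_toLex, Prod.Lex.toLex_le_toLex]
  have := s.sign_cases
  have h : rep 0 s.proj = rep 0 a → s.sign ≠ 0 := fun h h' =>
    (sign_eq_zero_iff s).1 h' (by rw [rep_injective 0 h]; exact a.2)
  change rep 0 a < _ ∨ rep 0 a = _ ∧ (0 : ℤ) < _ ↔ rep 0 a < _ ∨ rep 0 a = _ ∧ (1 : ℤ) ≤ _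
  grind

theorem mid_lt_mid_iff (a b : rationalPoints) :
    mid a < mid b ↔ coord (plus a) < coord (minus b) := by
  unfold coord mid
  rw [Prod.Lex.toLex_lt_toLex, Prod.Lex.toLex_lt_toLex]
  simp [proj, sign]

/-- A description using only `circ` and the points `a⁻`, which every natural action respects;
uniqueness of the action rests on it. -/
theorem cut_iff_circ_minus (s : Split rationalPoints) (a b : rationalPoints) :
    (cut s).1 a b = true ↔ (s = minus a ∧ a ≠ b) ∨ circ s (minus a) (minus b) := by
  rw [cut_iff, circ_iff, ← coord_injective.eq_iff, ← mid_injective.ne_iff]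
  have h1 := coord_lt_mid_iff s a
  have h2 := coord_lt_mid_iff s b
  have h3 := coord_lt_mid_iff (minus a) b
  have h4 := coord_lt_mid_iff (minus b) a
  have h5 := mid_ne_coord a s
  have h6 := mid_ne_coord b s
  have h7 := mid_lt_mid_iff a b
  have h8 := coord_lt_mid_iff (minus a) a
  have h9 := mid_lt_coord_iff (plus a) a
  have h10 := coord_lt_mid_iff (plus a) b
  have h11 := mid_ne_coord a (minus b)
  have h12 := mid_ne_coord b (plus a)
  have h13 := coord_lt_mid_iff (minus b) b
  have h14 : mid a = mid b ↔ coord (minus a) = coord (minus b) := by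
    rw [mid_injective.eq_iff, coord_injective.eq_iff, minus.injEq]
  unfold cyc
  grind

/-! ### The topology of the split circle -/

/-- The orders placing `a` before `b` come from the arc from `b⁺` to `a⁻`, which is a basic open set
of the interval topology. -/
theorem compl_interval_eq {a b : rationalPoints} (h : a ≠ b) :
    {s | (cut s).1 a b = true} = {s | circ (plus a) s (minus b) ∨ s = plus a ∨ s = minus b}ᶜ := by
  ext s
  change (cut s).1 a b = true ↔ ¬ (_ ∨ _ ∨ _)
  rw [cut_iff, circ_iff, ← coord_injective.eq_iff, ← coord_injective.eq_iff]
  have h1 := mid_lt_coord_iff s a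
  have h2 := coord_lt_mid_iff s b
  have h3 := mid_lt_mid_iff a b
  have h4 := mid_injective.ne h
  have h5 := mid_ne_coord a s
  have h6 := mid_ne_coord b s
  have h7 := coord_injective.ne (show plus a ≠ minus b by simp)
  unfold cyc
  grind

theorem isInducing_cut : IsInducing cut := by
  have hcont : Continuous cut := by
    refine AdmissibleOrders.isInducing_val.continuous_iff.2
      (continuous_pi fun a => continuous_pi fun b => ?_)
    rw [continuous_bool_rng true]
    have hopen : ∀ a b, IsOpen {s | (cut s).1 a b = true} := fun a b => by
      by_cases h : a = b
      · subst h
        convert isOpen_empty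
        ext s
        have := s.cut.sto
        exact iff_of_false (irrefl_of (fun a b => s.cut.1 a b = true) a) id
      · exact TopologicalSpace.isOpen_generateFrom_of_mem ⟨_, _, compl_interval_eq h⟩
    refine ⟨?_, hopen a b⟩
    by_cases h : a = b
    · convert isClosed_empty
      ext s
      subst h
      have := s.cut.sto
      exact iff_of_false (irrefl_of (fun a b => s.cut.1 a b = true) a) id
    · rw [← isOpen_compl_iff]
      convert hopen b a using 1
      ext s
      have := s.cut.sto
      have h1 := trichotomous_of (fun a b => s.cut.1 a b = true) a b
      refine ⟨fun h2 => ?_, fun h2 => asymm_of (fun a b => s.cut.1 a b = true) h2⟩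
      exact (h1.resolve_left h2).resolve_left h
  refine ⟨le_antisymm (continuous_iff_le_induced.1 hcont) (le_generateFrom ?_)⟩
  rintro _ ⟨s, t, rfl⟩
  let I : Set (Split rationalPoints) := {x | circ s x t ∨ x = s ∨ x = t}ᶜ
  -- For `u` outside `[s, t]`, choose `a` between `u` and `s`, and `b` between `t` and `u`. The
  -- points whose cut places `a` before `b` include `u` and avoid `[s, t]`.
  refine isOpen_induced_iff.2 ⟨⋃ p : {p : rationalPoints × rationalPoints |
    ∀ v, (cut v).1 p.1 p.2 = true → v ∈ I}, {x | x.1 p.1.1 p.1.2 = true}, ?_, ?_⟩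
  · exact isOpen_iUnion fun p => (isOpen_discrete {true}).preimage
      (AdmissibleOrders.continuous_apply p.1.1 p.1.2)
  · ext u
    simp only [Set.mem_preimage, Set.mem_iUnion]
    constructor
    · rintro ⟨p, hp⟩
      exact p.2 u hp
    · intro hu
      change ¬ (_ ∨ _ ∨ _) at hu
      simp only [not_or] at hu
      obtain ⟨h1, h2, h3⟩ := hu
      obtain ⟨a, ha⟩ := exists_mid_between h2
      obtain ⟨b, hb⟩ := exists_mid_between (Ne.symm h3)
      have hE : IsCircularOrder (cyc ((· < ·) : ℝ ×ₗ ℤ → ℝ ×ₗ ℤ → Prop)) := isCircularOrder_cyc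
      have h4 : coord s = coord t ∨ cyc (· < ·) (coord s) (coord t) (coord u) := by
        by_cases hst : s = t
        · exact Or.inl (congrArg _ hst)
        · rw [circ_iff] at h1
          exact Or.inr ((hE.total _ _ _ (coord_injective.ne hst) (coord_injective.ne (Ne.symm h3))
            (coord_injective.ne h2)).resolve_right h1)
      obtain ⟨h5, h6⟩ := cyc_arc_subset_compl ha hb h4
      refine ⟨⟨(a, b), fun v hv => ?_⟩, cut_iff.2 h5⟩
      have h7 := h6 _ (cut_iff.1 hv)
      rwa [coord_injective.eq_iff, coord_injective.eq_iff, ← circ_iff] at h7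

/-- The homeomorphism between the split circle and the space of admissible orders. -/
noncomputable def cutHomeomorph :
    Split rationalPoints ≃ₜ AdmissibleOrders circClass rationalPoints :=
  (Equiv.ofBijective cut ⟨cut_injective, cut_surjective⟩).toHomeomorphOfIsInducing isInducing_cut

end Split

/-! ### The action on the split circle -/

namespace Split

/-- The action on the split circle transported from the space of admissible orders. -/
@[reducible] noncomputable def splitAction :
    MulAction (autGroup circLang rationalPoints) (Split rationalPoints) where
  smul g s := cutHomeomorph.symm (g • cut s)
  one_smul s := by
    change cutHomeomorph.symm ((1 : autGroup circLang rationalPoints) • cutHomeomorph s) = s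
    rw [one_smul, Homeomorph.symm_apply_apply]
  mul_smul g h s := by
    change cutHomeomorph.symm ((g * h) • cutHomeomorph s) =
      cutHomeomorph.symm (g • cutHomeomorph (cutHomeomorph.symm (h • cutHomeomorph s)))
    rw [Homeomorph.apply_symm_apply, mul_smul]

theorem cut_splitAction (g : autGroup circLang rationalPoints) (s : Split rationalPoints) :
    cut (splitAction.smul g s) = g • cut s :=
  cutHomeomorph.apply_symm_apply (g • cut s)

theorem smul_cut_iff (g : autGroup circLang rationalPoints) (s : Split rationalPoints)
    (a b : rationalPoints) : (g • cut s).1 (g.1 a) (g.1 b) = (cut s).1 a b := by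
  rw [AdmissibleOrders.smul_apply, autGroup_inv_apply, autGroup_inv_apply]

theorem isNaturalAction_splitAction : IsNaturalAction splitAction := by
  have hcirc : ∀ (g : autGroup circLang rationalPoints) (s t u : Split rationalPoints),
      circ s t u → circ (splitAction.smul g s) (splitAction.smul g t) (splitAction.smul g u) := by
    intro g s t u h
    rw [circ_iff_cut] at h ⊢
    obtain ⟨a, b, c, h⟩ := h
    refine ⟨g.1 a, g.1 b, g.1 c, ?_⟩
    simpa only [cut_splitAction, smul_cut_iff] using h
  have hinv : ∀ (g : autGroup circLang rationalPoints) (s : Split rationalPoints),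
      splitAction.smul g⁻¹ (splitAction.smul g s) = s := fun g s => by
    apply cut_injective
    rw [cut_splitAction, cut_splitAction, inv_smul_smul]
  refine @IsNaturalAction.mk splitAction (fun g s t u => ⟨fun h => ?_, hcirc g s t u⟩) ?_ ?_
  · have := hcirc g⁻¹ _ _ _ h
    change circ (splitAction.smul g⁻¹ (splitAction.smul g s))
      (splitAction.smul g⁻¹ (splitAction.smul g t)) (splitAction.smul g⁻¹ (splitAction.smul g u)) at this
    rwa [hinv, hinv, hinv] at this
  · intro g q
    apply cut_injective
    refine (cut_splitAction g (minus q)).trans (eq_of_pred_iff (g.1 q) fun a => ?_)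
    rw [← autGroup_apply_inv g a, smul_cut_iff]
    exact iff_of_false (cut_minus_pred _ _) (cut_minus_pred _ _)
  · intro g q
    apply cut_injective
    refine (cut_splitAction g (plus q)).trans (eq_of_pred_iff (g.1 q) fun a => ?_)
    rw [← autGroup_apply_inv g a, smul_cut_iff, cut_plus_pred, cut_plus_pred]
    exact g.1.injective.ne_iff.symm

end Split

open Split

theorem IsNaturalAction.cut_smul [act : MulAction (autGroup circLang rationalPoints) (Split rationalPoints)]
    (h : IsNaturalAction act) (g : autGroup circLang rationalPoints) (s : Split rationalPoints) :
    cut (g • s) = g • cut s := by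
  refine AdmissibleOrders.ext_iff_true.2 fun a b => ?_
  obtain ⟨a, rfl⟩ := g.1.surjective a
  obtain ⟨b, rfl⟩ := g.1.surjective b
  rw [smul_cut_iff, cut_iff_circ_minus, cut_iff_circ_minus, ← h.smul_minus, ← h.smul_minus, h.circ_smul, smul_left_cancel_iff,
    g.1.injective.ne_iff]

theorem IsNaturalAction.eq_splitAction
    (act : MulAction (autGroup circLang rationalPoints) (Split rationalPoints))
    (h : IsNaturalAction act) : act = splitAction := by
  apply MulAction.ext
  funext g s
  exact cut_injective ((IsNaturalAction.cut_smul (act := act) h g s).trans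
    (cut_splitAction g s).symm)

theorem IsUniversalMinimalFlow.of_homeomorph {G X Y : Type*} [Group G] [TopologicalSpace G]
    [TopologicalSpace X] [MulAction G X] [TopologicalSpace Y] [MulAction G Y] (e : X ≃ₜ Y)
    (he : ∀ (g : G) x, e (g • x) = g • e x) (h : IsUniversalMinimalFlow.{u} G Y) :
    IsUniversalMinimalFlow.{u} G X := by
  obtain ⟨⟨⟨y⟩, h2, h3, h4, h5⟩, h6⟩ := h
  refine ⟨⟨⟨e.symm y⟩, e.symm.compactSpace, e.symm.t2Space, ⟨?_⟩, ⟨fun x => ?_⟩⟩, ?_⟩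
  · have h7 : Continuous fun p : G × X => e.symm (p.1 • e p.2) :=
      e.symm.continuous.comp (continuous_fst.smul (e.continuous.comp continuous_snd))
    refine h7.congr fun p => ?_
    rw [← he, e.symm_apply_apply]
  · have h7 : MulAction.orbit G x = e ⁻¹' MulAction.orbit G (e x) := by
      ext z
      constructor
      · rintro ⟨g, rfl⟩
        exact ⟨g, (he g x).symm⟩
      · rintro ⟨g, hg⟩
        exact ⟨g, e.injective ((he g x).trans hg)⟩
    rw [h7]
    exact (h5.dense_orbit (e x)).preimage e.isOpenMap
  · intro Z _ _ hZ
    obtain ⟨f, hf, hf'⟩ := h6 Z hZ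
    exact ⟨f ∘ e, hf.comp e.continuous, fun g x => by simp [he, hf']⟩

end CircularFlow

theorem mainTheorem3 :
    (IsFraisseOrderClass circClass ∧ IsReasonable circClass ∧ RamseyProperty circClass ∧
      OrderingProperty circClass) ∧
    (IsFraisseLimit (reductClass circClass) rationalPoints ∧
      ∀ α : ℝ, Irrational α →
        IsStrictTotalOrder rationalPoints (cutOrder α) ∧
        (∀ x y, cutOrder α x y → ∃ z, cutOrder α x z ∧ cutOrder α z y) ∧
        letI := expansionStructure (L₀ := circLang) rationalPoints (cutOrder α)
        IsFraisseLimit circClass rationalPoints) ∧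
    (IsUniversalMinimalFlow.{u} (autGroup circLang rationalPoints)
        (AdmissibleOrders circClass rationalPoints) ∧
      ∃ act : MulAction (autGroup circLang rationalPoints) (Split rationalPoints),
        IsNaturalAction act ∧ (∀ act', IsNaturalAction act' → act' = act) ∧
        IsUniversalMinimalFlow.{u} (autGroup circLang rationalPoints) (Split rationalPoints) ∧
        ∃ Φ : Split rationalPoints ≃ₜ AdmissibleOrders circClass rationalPoints,
          ∀ (g : autGroup circLang rationalPoints) (s : Split rationalPoints),
            Φ (g • s) = g • Φ s) := by
  have hflow := isUniversalMinimalFlow_admissibleOrders.{u} hasDenseCuts_rationalPoints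
  refine ⟨⟨isFraisseOrderClass_circClass, isReasonable_circClass, ramseyProperty_circClass,
    orderingProperty_circClass⟩, ⟨isFraisseLimit_reductClass _ hasDenseCuts_rationalPoints,
    fun α hα => ⟨(isDenseUnbounded_cutOrder hα).sto, (isDenseUnbounded_cutOrder hα).dense, ?_⟩⟩,
    hflow, Split.splitAction, Split.isNaturalAction_splitAction,
    IsNaturalAction.eq_splitAction, ?_, Split.cutHomeomorph, Split.cut_splitAction⟩
  · let _ := expansionStructure (L₀ := circLang) rationalPoints (cutOrder α)
    exact isFraisseLimit_circClass rationalPoints (isDenseUnbounded_cutOrder hα)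
      (circRel_iff_cyc_cutOrder hα)
  · let _ := Split.splitAction
    exact hflow.of_homeomorph Split.cutHomeomorph Split.cut_splitAction
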